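/- Let $d\ge 2$, let $B=B^d(1)=\{x\in\mathbb R^d:|x|<1\}$, and let $$F(x,y)=\frac{\sqrt{|y|^2-(|x|^2|y|^2-\langle x,y\rangle^2)}}{1-|x|^2}+\frac{\langle x,y\rangle}{1-|x|^2},\qquad x\in B,\ y\in\mathbb R^d,$$ be the Funk metric. Put $g_x(y,z)=\frac{\langle y,z\rangle}{1-|x|^2}+\frac{\langle x,y\rangle\langle x,z\rangle}{(1-|x|^2)^2}$ and $\beta_x(y)=\frac{\langle x,y\rangle}{1-|x|^2}$. For a Randers metric $F=\sqrt g+\beta$ on $B$ (with $g$ a Riemannian metric, $\beta$ a smooth one-form, and $\|\beta\|_g(x)<1$ for every $x$) let $F^*(x,\alpha)=\sup_{y\ne0}\alpha(y)/F(x,y)$, let $dV_F=(1-\|\beta\|_g^2)^{(d+1)/2}\,dv_g$, and let $$\|u\|_{W^{1,p}_F}=\Big(\int_B F^*(x,Du)^p\,dV_F+\int_B|u|^p\,dV_F\Big)^{1/p},$$ where $Du$ is the distributional derivative. Let $W^{1,p}_F(B)$ be the set of all $u\in W^{1,p}_{\rm loc}(B)$ with $\|u\|_{W^{1,p}_F}<\infty$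 that lie in the closure of $C^\infty(B)$ with respect to this asymmetric norm (for every $\varepsilon>0$ there is $\varphi\in C^\infty(B)$ with $\|u-\varphi\|_{W^{1,p}_F}<\varepsilon$ and $\|\varphi-u\|_{W^{1,p}_F}<\varepsilon$). The space $L^q(B)$ is taken with respect to $dV_F$. A pair $(p,q)\in(1,\infty)\times(1,\infty]$ is called $d$-admissible if $p<d$ and $p<q<\frac{pd}{d-p}$, or $p=d$ and $p<q<\infty$, or $p>d$ and $q=\infty$. Then: 1. $F=\sqrt g+\beta$ on $B\times\mathbb R^d$, and $(B,F)$ is a Randers space. The Riemannian manifold $(B,g)$ is a Hadamard manifold (simply connected, complete, with non-positive sectional curvature). Moreover $\sup_{x\in B}\|\beta\|_g(x)=1$, and the reversibility constant $r_F=\sup_{x\in B}\sup_{y\neq0}\frac{F(x,y)}{F(x,-y)}$ is infinite. 2. For every $d$-admissible pair $(p,q)$, put $t=\frac{p+q}2$ if $q<\infty$ and $t=\frac{p^2}{d}$ if $q=\infty$. Then the function $u(x)=|x|(1-|x|)^{-1/t}$ lies in $W^{1,p}_F(B)$, while $\|u\|_{L^q(B)}=+\infty$. 3. Consequently, for no $d$-admissible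 pair $(p,q)$ is $W^{1,p}_F(B)$ continuously embedded into $L^q(B)$; that is, there is no finite constant $C$ with $\|v\|_{L^q(B)}\le C\|v\|_{W^{1,p}_F}$ for all $v\in W^{1,p}_F(B)$. So a continuous embedding $W^{1,p}_F(M)\hookrightarrow L^q(M)$ for Randers spaces $(M,\sqrt g+\beta)$ with $(M,g)$ a Hadamard manifold can fail when the assumption $\sup_M\|\beta\|_g<1$ (equivalently $r_F<\infty$) is dropped. -/

import Mathlib

open MeasureTheory Set Filter Topology
open scoped NNReal ENNReal ContDiff Matrix

noncomputable section

namespace FunkModel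

/-- The Euclidean space `ℝ^d`; a domain in it is treated as a manifold with one global chart, and
tangent vectors are elements of `ℝ^d`. -/
abbrev E (d : ℕ) : Type := EuclideanSpace ℝ (Fin d)

/-- The open unit ball `B^d(1)`. -/
def unitBall (d : ℕ) : Set (E d) := Metric.ball 0 1

/-- Partial derivative in the `i`-th coordinate direction. -/
def pderiv {d : ℕ} (i : Fin d) (f : E d → ℝ) (x : E d) : ℝ :=
  fderiv ℝ f x (EuclideanSpace.single i 1)

/-! ### Riemannian metrics on a domain

A metric tensor is given by its components `g x i j`, a covector field by its components `β x i`. -/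

/-- `g` is a smooth Riemannian metric on `Ω`. -/
structure IsRiemannianMetric {d : ℕ} (Ω : Set (E d)) (g : E d → Matrix (Fin d) (Fin d) ℝ) :
    Prop where
  isOpen : IsOpen Ω
  smooth : ∀ i j, ContDiffOn ℝ ∞ (fun x => g x i j) Ω
  posDef : ∀ x ∈ Ω, (g x).PosDef

/-- `g_x(y, z)`. -/
def metricForm {d : ℕ} (g : E d → Matrix (Fin d) (Fin d) ℝ) (x y z : E d) : ℝ :=
  ∑ i, ∑ j, g x i j * y i * z j

/-- The co-metric `g*_x(α, α')` on covectors, given by the inverse matrix of `g_x`. -/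
def coMetric {d : ℕ} (g : E d → Matrix (Fin d) (Fin d) ℝ) (x : E d) (α α' : Fin d → ℝ) : ℝ :=
  ∑ i, ∑ j, (g x)⁻¹ i j * α i * α' j

/-- The norm `‖β‖_g(x)` of a one-form. -/
def formNorm {d : ℕ} (g : E d → Matrix (Fin d) (Fin d) ℝ) (β : E d → Fin d → ℝ) (x : E d) : ℝ :=
  Real.sqrt (coMetric g x (β x) (β x))

/-- Christoffel symbols `Γ^k_{ij}` of `g`. -/
def christoffel {d : ℕ} (g : E d → Matrix (Fin d) (Fin d) ℝ) (k i j : Fin d) (x : E d) : ℝ :=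
  (1 / 2) * ∑ l, (g x)⁻¹ k l *
    (pderiv i (fun z => g z j l) x + pderiv j (fun z => g z i l) x - pderiv l (fun z => g z i j) x)

/-- The component `R^l_{kij}` of the curvature tensor: `R(∂_i, ∂_j) ∂_k = ∑ l, R^l_{kij} ∂_l`, where
`R(X, Y) = ∇_X ∇_Y - ∇_Y ∇_X - ∇_[X,Y]`. -/
def riemannTensor {d : ℕ} (g : E d → Matrix (Fin d) (Fin d) ℝ) (l k i j : Fin d) (x : E d) : ℝ :=
  pderiv i (christoffel g l j k) x - pderiv j (christoffel g l i k) x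
    + ∑ m, (christoffel g l i m x * christoffel g m j k x
        - christoffel g l j m x * christoffel g m i k x)

/-- `g(R(X, Y)Y, X)`: the sectional curvature of the plane spanned by `X`, `Y`, times the positive
number `g(X,X) g(Y,Y) - g(X,Y)^2`. -/
def sectionalForm {d : ℕ} (g : E d → Matrix (Fin d) (Fin d) ℝ) (x X Y : E d) : ℝ :=
  ∑ i, ∑ j, ∑ k, ∑ l, ∑ s, g x l s * riemannTensor g l k i j x * X i * Y j * Y k * X s

/-! ### Length and distance -/

/-- `γ`, restricted to `[0,1]`, is a continuous, piecewise smooth curve in `Ω` from `x` to `y`; the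
set `S` contains the finitely many break points. -/
structure IsPiecewiseSmoothCurve {d : ℕ} (Ω : Set (E d)) (x y : E d) (γ : ℝ → E d) : Prop where
  mapsTo : MapsTo γ (Icc 0 1) Ω
  source : γ 0 = x
  target : γ 1 = y
  continuousOn : ContinuousOn γ (Icc 0 1)
  piecewise : ∃ S : Finset ℝ, ∀ a b : ℝ, 0 ≤ a → a < b → b ≤ 1 → (∀ s ∈ S, s ∉ Ioo a b) →
    ContDiffOn ℝ ∞ γ (Icc a b)

/-- Length of a curve with respect to a (Riemannian or Finsler) norm `F(x, y)`. -/
def curveLength {d : ℕ} (F : E d → E d → ℝ) (γ : ℝ → E d) : ℝ≥0∞ :=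
  ∫⁻ t in Icc (0 : ℝ) 1, ENNReal.ofReal (F (γ t) (deriv γ t))

/-- Distance induced on `Ω` by a norm `F(x, y)`. -/
def inducedDist {d : ℕ} (Ω : Set (E d)) (F : E d → E d → ℝ) (x y : E d) : ℝ≥0∞ :=
  ⨅ (γ : ℝ → E d) (_ : IsPiecewiseSmoothCurve Ω x y γ), curveLength F γ

/-- Riemannian distance of `(Ω, g)`. -/
def riemannianDist {d : ℕ} (Ω : Set (E d)) (g : E d → Matrix (Fin d) (Fin d) ℝ) (x y : E d) :
    ℝ≥0∞ :=
  inducedDist Ω (fun z v => Real.sqrt (metricForm g z v v)) x y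

/-- `(Ω, g)` is a Hadamard manifold: a simply connected, complete Riemannian manifold of
non-positive sectional curvature. -/
structure IsHadamard {d : ℕ} (Ω : Set (E d)) (g : E d → Matrix (Fin d) (Fin d) ℝ) : Prop where
  metric : IsRiemannianMetric Ω g
  simplyConnected : SimplyConnectedSpace Ω
  complete : ∀ s : ℕ → E d, (∀ n, s n ∈ Ω) →
    (∀ ε : ℝ≥0∞, 0 < ε → ∃ N, ∀ m ≥ N, ∀ n ≥ N, riemannianDist Ω g (s m) (s n) < ε) →
    ∃ x ∈ Ω, Tendsto (fun n => riemannianDist Ω g (s n) x) atTop (𝓝 0)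
  curvature_nonpos : ∀ x ∈ Ω, ∀ X Y : E d, sectionalForm g x X Y ≤ 0

/-! ### Randers metrics -/

/-- The Randers metric `F(x, y) = √(g_x(y, y)) + β_x(y)`. -/
def randersMetric {d : ℕ} (g : E d → Matrix (Fin d) (Fin d) ℝ) (β : E d → Fin d → ℝ)
    (x y : E d) : ℝ :=
  Real.sqrt (metricForm g x y y) + ∑ i, β x i * y i

/-- `(Ω, √g + β)` is a Randers space: `g` is a Riemannian metric and `β` a smooth one-form with
`‖β‖_g(x) < 1` at every point. -/
structure IsRandersSpace {d : ℕ} (Ω : Set (E d)) (g : E d → Matrix (Fin d) (Fin d) ℝ)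
    (β : E d → Fin d → ℝ) : Prop where
  metric : IsRiemannianMetric Ω g
  smooth : ∀ i, ContDiffOn ℝ ∞ (fun x => β x i) Ω
  formNorm_lt_one : ∀ x ∈ Ω, formNorm g β x < 1

/-- The reversibility constant `r_F = sup_x sup_{y ≠ 0} F(x, y) / F(x, -y)`, in `[0, ∞]`. -/
def reversibility {d : ℕ} (Ω : Set (E d)) (F : E d → E d → ℝ) : ℝ≥0∞ :=
  ⨆ (x ∈ Ω) (y : E d) (_ : y ≠ 0), ENNReal.ofReal (F x y / F x (-y))

/-- The polar transform `F*(x, α) = sup_{y ≠ 0} α(y) / F(x, y)`. It is a non-negative number, so that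
truncating the quotients at `0` does not change the supremum. -/
def polarTransform {d : ℕ} (F : E d → E d → ℝ) (x : E d) (α : Fin d → ℝ) : ℝ≥0∞ :=
  ⨆ (y : E d) (_ : y ≠ 0), ENNReal.ofReal ((∑ i, α i * y i) / F x y)

/-- The Hausdorff volume `dV_F = (1 - ‖β‖_g²)^((d+1)/2) dv_g`, `dv_g = √(det g) dx`, on `Ω`. -/
def randersVolume {d : ℕ} (Ω : Set (E d)) (g : E d → Matrix (Fin d) (Fin d) ℝ)
    (β : E d → Fin d → ℝ) : Measure (E d) :=
  (volume.restrict Ω).withDensity fun x =>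
    ENNReal.ofReal ((1 - formNorm g β x ^ 2) ^ (((d : ℝ) + 1) / 2) * Real.sqrt (g x).det)

/-! ### Sobolev spaces -/

/-- `Du` (by components) is the distributional derivative of `u` on `Ω`; both are locally
integrable. -/
structure HasWeakDeriv {d : ℕ} (Ω : Set (E d)) (u : E d → ℝ) (Du : E d → Fin d → ℝ) : Prop where
  locallyIntegrable : LocallyIntegrableOn u Ω
  locallyIntegrable_deriv : ∀ i, LocallyIntegrableOn (fun x => Du x i) Ω
  integral_eq : ∀ φ : E d → ℝ, ContDiff ℝ ∞ φ → HasCompactSupport φ → tsupport φ ⊆ Ω →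
    ∀ i, ∫ x in Ω, u x * pderiv i φ x = - ∫ x in Ω, Du x i * φ x

/-- `u ∈ W^{1,p}_loc(Ω)`. -/
def MemSobolevLoc {d : ℕ} (Ω : Set (E d)) (p : ℝ) (u : E d → ℝ) : Prop :=
  ∃ Du : E d → Fin d → ℝ, HasWeakDeriv Ω u Du ∧ ∀ K ⊆ Ω, IsCompact K →
    MemLp u (ENNReal.ofReal p) (volume.restrict K) ∧
    ∀ i, MemLp (fun x => Du x i) (ENNReal.ofReal p) (volume.restrict K)

/-- The asymmetric norm `(∫ F*(x, Du)^p dV_F + ∫ |u|^p dV_F)^(1/p)` in `[0, ∞]`, for the Randers metric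
`F = √g + β`. The weak derivative is unique up to null sets, so that the infimum is
over one value; it is `∞` if `u` has no weak derivative. -/
def sobolevNorm {d : ℕ} (Ω : Set (E d)) (g : E d → Matrix (Fin d) (Fin d) ℝ)
    (β : E d → Fin d → ℝ) (p : ℝ) (u : E d → ℝ) : ℝ≥0∞ :=
  ⨅ (Du : E d → Fin d → ℝ) (_ : HasWeakDeriv Ω u Du),
    ((∫⁻ x, polarTransform (randersMetric g β) x (Du x) ^ p ∂(randersVolume Ω g β))
      + ∫⁻ x, ‖u x‖ₑ ^ p ∂(randersVolume Ω g β)) ^ (1 / p)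

/-- `u ∈ W^{1,p}_F(Ω)`: `u` lies in `W^{1,p}_loc(Ω)`, has finite norm, and is in the closure of
`C^∞(Ω)` for the asymmetric norm (in both orders of the difference). -/
structure MemSobolev {d : ℕ} (Ω : Set (E d)) (g : E d → Matrix (Fin d) (Fin d) ℝ)
    (β : E d → Fin d → ℝ) (p : ℝ) (u : E d → ℝ) : Prop where
  memLoc : MemSobolevLoc Ω p u
  norm_lt_top : sobolevNorm Ω g β p u < ⊤
  mem_closure : ∀ ε : ℝ≥0∞, 0 < ε → ∃ φ : E d → ℝ, ContDiffOn ℝ ∞ φ Ω ∧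
    sobolevNorm Ω g β p (fun x => u x - φ x) < ε ∧ sobolevNorm Ω g β p (fun x => φ x - u x) < ε

/-- The continuous embedding `W^{1,p}_F(Ω) ↪ L^q(Ω)`: there is a finite `C` such that
`‖u‖_{L^q} ≤ C ‖u‖_{W^{1,p}_F}` for every `u ∈ W^{1,p}_F(Ω)`; in particular every such `u` has finite
`L^q` norm. -/
def ContinuouslyEmbeds {d : ℕ} (Ω : Set (E d)) (g : E d → Matrix (Fin d) (Fin d) ℝ)
    (β : E d → Fin d → ℝ) (p : ℝ) (q : ℝ≥0∞) : Prop :=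
  ∃ C : ℝ≥0, ∀ u : E d → ℝ, MemSobolev Ω g β p u →
    eLpNorm u q (randersVolume Ω g β) ≤ C * sobolevNorm Ω g β p u

/-- `(p, q) ∈ (1, ∞) × (1, ∞]` is a `d`-admissible pair. -/
def IsAdmissible (d : ℕ) (p : ℝ) (q : ℝ≥0∞) : Prop :=
  1 < p ∧
    ((p < d ∧ ENNReal.ofReal p < q ∧ q < ENNReal.ofReal (p * d / (d - p))) ∨
     (p = d ∧ ENNReal.ofReal p < q ∧ q < ⊤) ∨
     ((d : ℝ) < p ∧ q = ⊤))

/-! ### The Funk model -/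

/-- The Funk metric on the unit ball. -/
def funkMetric {d : ℕ} (x y : E d) : ℝ :=
  Real.sqrt (‖y‖ ^ 2 - (‖x‖ ^ 2 * ‖y‖ ^ 2 - inner ℝ x y ^ 2)) / (1 - ‖x‖ ^ 2)
    + inner ℝ x y / (1 - ‖x‖ ^ 2)

/-- The Riemannian part of the Funk metric (the Klein metric). -/
def kleinMetric {d : ℕ} (x : E d) : Matrix (Fin d) (Fin d) ℝ :=
  Matrix.of fun i j => (if i = j then 1 else 0) / (1 - ‖x‖ ^ 2) + x i * x j / (1 - ‖x‖ ^ 2) ^ 2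

/-- The one-form part of the Funk metric. -/
def funkForm {d : ℕ} (x : E d) : Fin d → ℝ := fun i => x i / (1 - ‖x‖ ^ 2)

/-- The function `|x| (1 - |x|)^(-1/t)`. -/
def funkFunction {d : ℕ} (t : ℝ) (x : E d) : ℝ := ‖x‖ * (1 - ‖x‖) ^ (-(1 / t))

end FunkModel

end

open MeasureTheory Set Filter Topology
open scoped NNReal ENNReal ContDiff Matrix

namespace FunkModel

variable {d : ℕ}

/-! Write $w = 1-|x|^2$. The one-form has $g$-norm $|x|$ and $\det g = w^{-(d+1)}$, so the two
factors of the Hausdorff density cancel and $dV_F$ is Lebesgue measure on the ball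
(`randersVolume_funk`). The polar transform is bounded by $|\alpha| - \langle\alpha,x\rangle$
(`polarTransform_funk_le`). A radial function $k(|x|)$ with $k'\ge 0$ therefore has $F^*(x,Du)\le
k'(|x|)(1-|x|)$: outward growth is discounted by exactly the distance to the sphere, because
$\|\beta\|_g$ tends to $1$ there.

For $k(s)=s(1-s)^{-1/t}$ this discount cancels the extra power that differentiation produces, and
both $F^*(x,Du)$ and $|u|$ are $O((1-|x|)^{-1/t})$. In polar coordinates the $p$-th powers are
integrable since $p<t$ (`sobolevNorm_funkFunction_lt_top`), while the $q$-th power of $u$ is not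
once $q\ge t$ (`lintegral_funkProfile_rpow_eq_top`). The exponent $t$ satisfies $p<t\le q$ for every
admissible pair, so $u$ refutes any embedding constant. Smooth approximation is an issue only at the
origin, where $|x|$ is not smooth; cutting $u$ off there costs little because $u$ vanishes at $0$.

That $g$ is Hadamard is the classical fact that the Klein ball is hyperbolic space. The curvature is
computed explicitly to be $-1$; completeness comes from comparing the distance with functions of
gradient at most one, including $\tfrac12\log w$, which keeps Cauchy sequences away from the sphere.
-/

lemma mem_unitBall {x : E d} : x ∈ unitBall d ↔ ‖x‖ < 1 := by
  simp [unitBall]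

lemma isOpen_unitBall : IsOpen (unitBall d) := Metric.isOpen_ball

lemma one_sub_norm_sq_pos {x : E d} (hx : x ∈ unitBall d) : 0 < 1 - ‖x‖ ^ 2 := by
  have := mem_unitBall.1 hx
  nlinarith [norm_nonneg x]

lemma inner_eq_sum (x y : E d) : inner ℝ x y = ∑ i, x i * y i := by
  simp [PiLp.inner_apply, mul_comm]

lemma norm_sq_eq_sum (x : E d) : ‖x‖ ^ 2 = ∑ i, x i * x i := by
  rw [← inner_eq_sum, real_inner_self_eq_norm_sq]

/-! ### The Klein metric, the one-form and the volume -/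

lemma kleinMetric_apply (x : E d) (i j : Fin d) :
    kleinMetric x i j =
      (if i = j then 1 else 0) / (1 - ‖x‖ ^ 2) + x i * x j / (1 - ‖x‖ ^ 2) ^ 2 := rfl

lemma kleinMetric_symm (x : E d) (i j : Fin d) : kleinMetric x i j = kleinMetric x j i := by
  simp only [kleinMetric_apply, eq_comm, mul_comm]

lemma metricForm_kleinMetric (x y z : E d) :
    metricForm kleinMetric x y z =
      inner ℝ y z / (1 - ‖x‖ ^ 2) + inner ℝ x y * inner ℝ x z / (1 - ‖x‖ ^ 2) ^ 2 := by
  simp only [metricForm, kleinMetric_apply, inner_eq_sum, Finset.sum_mul_sum, Finset.sum_div,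
    add_mul, Finset.sum_add_distrib]
  congr 1
  · refine Finset.sum_congr rfl fun i _ => ?_
    rw [Finset.sum_eq_single i]
    · simp; ring
    · intro j _ h; simp [Ne.symm h]
    · simp
  · refine Finset.sum_congr rfl fun i _ => Finset.sum_congr rfl fun j _ => by ring

lemma sum_funkForm_mul (x y : E d) : ∑ i, funkForm x i * y i = inner ℝ x y / (1 - ‖x‖ ^ 2) := by
  simp only [inner_eq_sum, funkForm, Finset.sum_div]
  exact Finset.sum_congr rfl fun i _ => by ring

lemma metricForm_self_kleinMetric (x y : E d) :
    metricForm kleinMetric x y y =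
      ‖y‖ ^ 2 / (1 - ‖x‖ ^ 2) + (inner ℝ x y / (1 - ‖x‖ ^ 2)) ^ 2 := by
  rw [metricForm_kleinMetric, real_inner_self_eq_norm_sq, div_pow, sq (inner ℝ x y)]

lemma metricForm_self_pos {x : E d} (hx : x ∈ unitBall d) {y : E d} (hy : y ≠ 0) :
    0 < metricForm kleinMetric x y y := by
  have := one_sub_norm_sq_pos hx
  have := norm_pos_iff.2 hy
  rw [metricForm_self_kleinMetric]
  positivity

lemma posDef_kleinMetric {x : E d} (hx : x ∈ unitBall d) : (kleinMetric x).PosDef := by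
  refine Matrix.PosDef.of_dotProduct_mulVec_pos ?_ fun y hy => ?_
  · exact Matrix.IsHermitian.ext fun i j => by rw [star_trivial, kleinMetric_symm]
  · have h := metricForm_self_pos hx (y := WithLp.toLp 2 y) (by simpa using hy)
    refine h.trans_eq ?_
    simp only [metricForm, dotProduct, Matrix.mulVec, Finset.mul_sum]
    refine Finset.sum_congr rfl fun i _ => Finset.sum_congr rfl fun j _ => ?_
    rw [star_trivial]; ring

lemma contDiffOn_one_sub_norm_sq {s : Set (E d)} :
    ContDiffOn ℝ ∞ (fun x : E d => 1 - ‖x‖ ^ 2) s :=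
  (contDiff_const.sub (contDiff_norm_sq ℝ)).contDiffOn

lemma contDiff_coord (i : Fin d) : ContDiff ℝ ∞ (fun x : E d => x i) :=
  (EuclideanSpace.proj i : E d →L[ℝ] ℝ).contDiff

lemma isRiemannianMetric_kleinMetric : IsRiemannianMetric (unitBall d) kleinMetric where
  isOpen := isOpen_unitBall
  smooth i j := by
    simp only [kleinMetric_apply]
    refine ContDiffOn.add (ContDiffOn.div contDiffOn_const contDiffOn_one_sub_norm_sq ?_)
      (ContDiffOn.div ((contDiff_coord i).mul (contDiff_coord j)).contDiffOn
        (contDiffOn_one_sub_norm_sq.pow 2) ?_)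
    · exact fun x hx => (one_sub_norm_sq_pos hx).ne'
    · exact fun x hx => (pow_pos (one_sub_norm_sq_pos hx) 2).ne'
  posDef _ hx := posDef_kleinMetric hx

/-- The inverse of the Klein metric. -/
lemma inv_kleinMetric {x : E d} (hx : x ∈ unitBall d) :
    (kleinMetric x)⁻¹ =
      Matrix.of fun i j => (1 - ‖x‖ ^ 2) * ((if i = j then 1 else 0) - x i * x j) := by
  have hw := (one_sub_norm_sq_pos hx).ne'
  refine Matrix.inv_eq_right_inv ?_
  ext i k
  simp only [Matrix.mul_apply, Matrix.of_apply, kleinMetric_apply, Matrix.one_apply]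
  have h : ∀ j, ((if i = j then (1 : ℝ) else 0) / (1 - ‖x‖ ^ 2) + x i * x j / (1 - ‖x‖ ^ 2) ^ 2) *
      ((1 - ‖x‖ ^ 2) * ((if j = k then 1 else 0) - x j * x k)) =
      (if i = j then (if j = k then (1 : ℝ) else 0) - x j * x k else 0) +
      (if j = k then x i * x j / (1 - ‖x‖ ^ 2) else 0)
      - x i * x k / (1 - ‖x‖ ^ 2) * (x j * x j) := by
    intro j
    split_ifs <;> field_simp <;> ring
  simp only [h, Finset.sum_add_distrib, Finset.sum_sub_distrib, ← Finset.mul_sum,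
    ← norm_sq_eq_sum, Finset.sum_ite_eq, Finset.sum_ite_eq', Finset.mem_univ, if_true]
  field_simp
  ring

/-- Up to the scalar $w^{-1}$ the metric is a rank-one perturbation of the identity, so the matrix
determinant lemma applies. -/
lemma det_kleinMetric {x : E d} (hx : x ∈ unitBall d) :
    (kleinMetric x).det = ((1 - ‖x‖ ^ 2) ^ (d + 1))⁻¹ := by
  have hw := (one_sub_norm_sq_pos hx).ne'
  have h : kleinMetric x = (1 - ‖x‖ ^ 2)⁻¹ • (1 + Matrix.replicateCol Unit (fun i => x i) *
      Matrix.replicateRow Unit (fun i => (1 - ‖x‖ ^ 2)⁻¹ * x i)) := by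
    ext i j
    simp only [kleinMetric_apply, Matrix.smul_apply, Matrix.add_apply, Matrix.one_apply,
      Matrix.mul_apply, Matrix.replicateCol_apply, Matrix.replicateRow_apply, smul_eq_mul]
    simp
    split_ifs <;> field_simp
  have h2 : ∑ i, ((1 - ‖x‖ ^ 2)⁻¹ * x i) * x i = (1 - ‖x‖ ^ 2)⁻¹ * ‖x‖ ^ 2 := by
    rw [norm_sq_eq_sum x, Finset.mul_sum]; simp [mul_assoc]
  rw [h, Matrix.det_smul, Matrix.det_one_add_replicateCol_mul_replicateRow, dotProduct, h2]
  simp only [Fintype.card_fin, inv_pow]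
  field_simp
  rw [sub_add_cancel, one_mul, pow_succ, mul_comm]

lemma formNorm_kleinMetric {x : E d} (hx : x ∈ unitBall d) :
    formNorm kleinMetric funkForm x = ‖x‖ := by
  have hw := (one_sub_norm_sq_pos hx).ne'
  rw [formNorm, ← Real.sqrt_sq (norm_nonneg x)]
  congr 1
  simp only [coMetric, inv_kleinMetric hx, Matrix.of_apply, funkForm]
  have h : ∀ i j, (1 - ‖x‖ ^ 2) * ((if i = j then 1 else 0) - x i * x j) *
      (x i / (1 - ‖x‖ ^ 2)) * (x j / (1 - ‖x‖ ^ 2)) =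
      (if i = j then x i * x j / (1 - ‖x‖ ^ 2) else 0) -
      (x i * x i) / (1 - ‖x‖ ^ 2) * (x j * x j) := by
    intro i j
    split_ifs
    · field_simp
    · field_simp
      ring
  simp only [h, Finset.sum_sub_distrib, ← Finset.mul_sum, Finset.sum_ite_eq, Finset.mem_univ,
    if_true, ← Finset.sum_mul, ← Finset.sum_div, ← norm_sq_eq_sum]
  field_simp

lemma isRandersSpace_funk : IsRandersSpace (unitBall d) kleinMetric funkForm where
  metric := isRiemannianMetric_kleinMetric
  smooth i := (contDiff_coord i).contDiffOn.div contDiffOn_one_sub_norm_sq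
    fun _ hx => (one_sub_norm_sq_pos hx).ne'
  formNorm_lt_one x hx := by
    rw [formNorm_kleinMetric hx]
    exact mem_unitBall.1 hx

lemma randersMetric_eq_funkMetric {x : E d} (hx : x ∈ unitBall d) (y : E d) :
    funkMetric x y = randersMetric kleinMetric funkForm x y := by
  have hw := one_sub_norm_sq_pos hx
  rw [funkMetric, randersMetric, sum_funkForm_mul, metricForm_self_kleinMetric]
  congr 1
  rw [← Real.sqrt_sq hw.le, ← Real.sqrt_div' _ (sq_nonneg _), Real.sqrt_sq hw.le]
  congr 1
  field_simp
  ring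

lemma randersVolume_funk :
    randersVolume (unitBall d) kleinMetric funkForm = volume.restrict (unitBall d) := by
  rw [randersVolume]
  conv_rhs => rw [← withDensity_one (μ := volume.restrict (unitBall d))]
  refine withDensity_congr_ae ?_
  filter_upwards [ae_restrict_mem isOpen_unitBall.measurableSet] with x hx
  have hw := one_sub_norm_sq_pos hx
  rw [formNorm_kleinMetric hx, det_kleinMetric hx, Real.sqrt_eq_rpow, Real.inv_rpow (by positivity),
    ← Real.rpow_natCast (1 - ‖x‖ ^ 2) (d + 1), ← Real.rpow_mul hw.le]
  have : ((d + 1 : ℕ) : ℝ) * (1 / 2) = ((d : ℝ) + 1) / 2 := by push_cast; ring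
  rw [this, mul_inv_cancel₀ (by positivity)]
  simp

/-! ### Degeneration at the boundary -/

lemma isLUB_formNorm (hd : 2 ≤ d) :
    IsLUB (formNorm kleinMetric funkForm '' unitBall d) 1 := by
  constructor
  · rintro _ ⟨x, hx, rfl⟩
    rw [formNorm_kleinMetric hx]
    exact (mem_unitBall.1 hx).le
  · intro b hb
    refine le_of_forall_lt_imp_le_of_dense fun r hr => ?_
    rcases lt_or_ge r 0 with h | h
    · have h0 : (0 : E d) ∈ unitBall d := by simp [mem_unitBall]
      have := hb ⟨0, h0, rfl⟩
      rw [formNorm_kleinMetric h0, norm_zero] at this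
      linarith
    · have hn : ‖(EuclideanSpace.single ⟨0, by omega⟩ r : E d)‖ = r := by simp [abs_of_nonneg h]
      have hx : (EuclideanSpace.single ⟨0, by omega⟩ r : E d) ∈ unitBall d := by
        rw [mem_unitBall, hn]; exact hr
      have := hb ⟨_, hx, rfl⟩
      rwa [formNorm_kleinMetric hx, hn] at this

lemma reversibility_funk (hd : 2 ≤ d) :
    reversibility (unitBall d) (funkMetric (d := d)) = ⊤ := by
  refine ENNReal.eq_top_of_forall_nnreal_le fun K => ?_
  obtain ⟨r, hr0, hr1, hr⟩ : ∃ r : ℝ, 0 ≤ r ∧ r < 1 ∧ K ≤ (1 + r) / (1 - r) := by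
    have hK := K.2
    -- With this radius $(1+r)/(1-r) = 2K+1$; at $x = re$ in the direction $e$ that ratio is exactly
    -- $F(x,e)/F(x,-e)$.
    refine ⟨1 - 1 / (K + 1 : ℝ), ?_, ?_, ?_⟩
    · have : 1 / (K + 1 : ℝ) ≤ 1 := by
        rw [div_le_one (by positivity)]; linarith [K.2, show (K : ℝ) = K.1 from rfl]
      linarith
    · have : 0 < 1 / (K + 1 : ℝ) := by positivity
      linarith
    · field_simp
      ring_nf
      nlinarith [K.2, show (K : ℝ) = K.1 from rfl]
  set e : E d := EuclideanSpace.single ⟨0, by omega⟩ 1 with he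
  have hne : ‖e‖ = 1 := by simp [he]
  have hnr : ‖r • e‖ = r := by rw [norm_smul, hne, Real.norm_of_nonneg hr0, mul_one]
  have hx : r • e ∈ unitBall d := by rwa [mem_unitBall, hnr]
  have hin : inner ℝ (r • e) e = r := by
    rw [real_inner_smul_left, real_inner_self_eq_norm_sq, hne]; ring
  have e0 : e ≠ 0 := by rw [← norm_pos_iff, hne]; norm_num
  refine le_trans ?_ (le_iSup₂_of_le (r • e) hx (le_iSup₂_of_le e e0 le_rfl))
  rw [← ENNReal.ofReal_coe_nnreal]
  refine ENNReal.ofReal_le_ofReal (hr.trans_eq ?_)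
  have hw : 1 - r ^ 2 ≠ 0 := by nlinarith
  have h1 : 1 - r ≠ 0 := by linarith
  have h2 : 1 + r ≠ 0 := by linarith
  have h3 : 1 - r ^ 2 = (1 - r) * (1 + r) := by ring
  simp only [funkMetric, norm_neg, inner_neg_right, hnr, hne, hin]
  norm_num
  have h4 : (1 - r ^ 2)⁻¹ + -r / (1 - r ^ 2) = (1 - r) / (1 - r ^ 2) := by field_simp; ring
  have h5 : (1 - r ^ 2)⁻¹ + r / (1 - r ^ 2) = (1 + r) / (1 - r ^ 2) := by field_simp
  rw [h4, h5, div_div_div_cancel_right₀ hw]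

/-! ### Curvature -/

lemma hasFDerivAt_coord (i : Fin d) (x : E d) :
    HasFDerivAt (fun z : E d => z i) (EuclideanSpace.proj i : E d →L[ℝ] ℝ) x :=
  (EuclideanSpace.proj i : E d →L[ℝ] ℝ).hasFDerivAt

lemma hasFDerivAt_inv_one_sub_norm_sq {x : E d} (hx : x ∈ unitBall d) :
    HasFDerivAt (fun z : E d => (1 - ‖z‖ ^ 2)⁻¹) ((2 / (1 - ‖x‖ ^ 2) ^ 2) • innerSL ℝ x) x := by
  have hN : HasFDerivAt (fun z : E d => 1 - ‖z‖ ^ 2) (-(2 • innerSL ℝ x)) x :=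
    (hasStrictFDerivAt_norm_sq x).hasFDerivAt.const_sub 1
  refine ((hasDerivAt_inv (one_sub_norm_sq_pos hx).ne').comp_hasFDerivAt x hN).congr_fderiv ?_
  rw [← Nat.cast_smul_eq_nsmul ℝ, smul_neg, neg_smul, neg_neg, smul_smul]
  congr 1
  push_cast
  ring

lemma proj_single (i j : Fin d) :
    (EuclideanSpace.proj j : E d →L[ℝ] ℝ) (EuclideanSpace.single i 1) = if i = j then 1 else 0 := by
  simp [eq_comm]

lemma innerSL_single (x : E d) (i : Fin d) :
    innerSL ℝ x (EuclideanSpace.single i (1 : ℝ)) = x i := by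
  simp [EuclideanSpace.inner_single_right]

lemma pderiv_kleinMetric {x : E d} (hx : x ∈ unitBall d) (i j l : Fin d) :
    pderiv i (fun z => kleinMetric z j l) x =
      2 * x i * (if j = l then 1 else 0) / (1 - ‖x‖ ^ 2) ^ 2 +
      ((if i = j then 1 else 0) * x l + x j * (if i = l then 1 else 0)) / (1 - ‖x‖ ^ 2) ^ 2 +
      4 * x i * x j * x l / (1 - ‖x‖ ^ 2) ^ 3 := by
  have hw := (one_sub_norm_sq_pos hx).ne'
  have hI := hasFDerivAt_inv_one_sub_norm_sq hx
  have h := (hI.const_mul (if j = l then (1 : ℝ) else 0)).add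
    (((hasFDerivAt_coord j x).mul (hasFDerivAt_coord l x)).mul (hI.mul hI))
  have h' := h.congr_of_eventuallyEq (f₁ := fun z => kleinMetric z j l) (.of_forall fun z => by
    simp [kleinMetric_apply, div_eq_mul_inv, sq])
  rw [pderiv, h'.fderiv]
  simp only [_root_.add_apply, _root_.smul_apply, smul_eq_mul, Pi.mul_apply,
    proj_single, innerSL_single]
  field_simp
  ring

/-- The metric derivatives combine to $\frac{2}{w}(x_i g_{lj} + x_j g_{li})$, so contraction with
the inverse metric leaves only Kronecker deltas. -/
lemma christoffel_kleinMetric {x : E d} (hx : x ∈ unitBall d) (k i j : Fin d) :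
    christoffel kleinMetric k i j x =
      ((if k = i then 1 else 0) * x j + (if k = j then 1 else 0) * x i) / (1 - ‖x‖ ^ 2) := by
  have hw := (one_sub_norm_sq_pos hx).ne'
  have h : ∀ l, pderiv i (fun z => kleinMetric z j l) x + pderiv j (fun z => kleinMetric z i l) x
      - pderiv l (fun z => kleinMetric z i j) x =
      2 / (1 - ‖x‖ ^ 2) * (x i * kleinMetric x l j + x j * kleinMetric x l i) := by
    intro l
    rw [pderiv_kleinMetric hx, pderiv_kleinMetric hx, pderiv_kleinMetric hx]
    simp only [kleinMetric_apply, eq_comm (a := l), eq_comm (a := j) (b := i)]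
    field_simp
    ring
  have hinv : ∀ j, ∑ l, (kleinMetric x)⁻¹ k l * kleinMetric x l j = if k = j then 1 else 0 := by
    intro j
    rw [← Matrix.mul_apply, Matrix.nonsing_inv_mul, Matrix.one_apply]
    exact (posDef_kleinMetric hx).det_pos.ne'.isUnit
  simp only [christoffel, h]
  have h2 : ∀ l, (kleinMetric x)⁻¹ k l *
      (2 / (1 - ‖x‖ ^ 2) * (x i * kleinMetric x l j + x j * kleinMetric x l i)) =
      2 / (1 - ‖x‖ ^ 2) * x i * ((kleinMetric x)⁻¹ k l * kleinMetric x l j) +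
      2 / (1 - ‖x‖ ^ 2) * x j * ((kleinMetric x)⁻¹ k l * kleinMetric x l i) := by
    intro l; ring
  simp only [h2, Finset.sum_add_distrib, ← Finset.mul_sum, hinv]
  ring

/-- Splitting $\partial_m(x_j/w)$ into $g_{mj}$ and a remainder isolates the part that survives in
the curvature; the remainder cancels against the products of Christoffel symbols. -/
lemma pderiv_christoffel {x : E d} (hx : x ∈ unitBall d) (m k i j : Fin d) :
    pderiv m (christoffel kleinMetric k i j) x =
      (if k = i then 1 else 0) * (kleinMetric x m j + x m * x j / (1 - ‖x‖ ^ 2) ^ 2) +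
      (if k = j then 1 else 0) * (kleinMetric x m i + x m * x i / (1 - ‖x‖ ^ 2) ^ 2) := by
  have hw := (one_sub_norm_sq_pos hx).ne'
  have hI := hasFDerivAt_inv_one_sub_norm_sq hx
  have h := (((hasFDerivAt_coord j x).const_mul (if k = i then (1 : ℝ) else 0)).add
    ((hasFDerivAt_coord i x).const_mul (if k = j then (1 : ℝ) else 0))).mul hI
  have h' := h.congr_of_eventuallyEq (f₁ := christoffel kleinMetric k i j) (by
    filter_upwards [isOpen_unitBall.mem_nhds hx] with z hz
    simp [christoffel_kleinMetric hz, div_eq_mul_inv])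
  rw [pderiv, h'.fderiv]
  simp only [_root_.add_apply, _root_.smul_apply, smul_eq_mul, Pi.add_apply,
    proj_single, innerSL_single, kleinMetric_apply]
  field_simp
  ring

/-- This is the curvature tensor of constant sectional curvature $-1$. -/
lemma riemannTensor_kleinMetric {x : E d} (hx : x ∈ unitBall d) (l k i j : Fin d) :
    riemannTensor kleinMetric l k i j x =
      (if l = j then 1 else 0) * kleinMetric x i k - (if l = i then 1 else 0) * kleinMetric x j k := by
  have hw := (one_sub_norm_sq_pos hx).ne'
  have hq : ∀ i j, ∑ m, christoffel kleinMetric l i m x * christoffel kleinMetric m j k x =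
      (2 * (if l = i then 1 else 0) * x j * x k + (if l = j then 1 else 0) * x i * x k +
        (if l = k then 1 else 0) * x i * x j) / (1 - ‖x‖ ^ 2) ^ 2 := by
    intro i j
    simp only [christoffel_kleinMetric hx]
    have h : ∀ m, ((if l = i then 1 else 0) * x m + (if l = m then 1 else 0) * x i) /
        (1 - ‖x‖ ^ 2) *
        (((if m = j then 1 else 0) * x k + (if m = k then 1 else 0) * x j) / (1 - ‖x‖ ^ 2)) =
        (if m = j then (if l = i then 1 else 0) * x m * x k / (1 - ‖x‖ ^ 2) ^ 2 else 0) +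
        (if m = k then (if l = i then 1 else 0) * x m * x j / (1 - ‖x‖ ^ 2) ^ 2 else 0) +
        (if l = m then x i * ((if m = j then 1 else 0) * x k + (if m = k then 1 else 0) * x j) /
          (1 - ‖x‖ ^ 2) ^ 2 else 0) := by
      intro m
      rw [div_mul_div_comm, ← sq]
      simp only [ite_mul, one_mul, zero_mul, ite_div, zero_div]
      split_ifs <;> ring
    simp only [h, Finset.sum_add_distrib, Finset.sum_ite_eq, Finset.sum_ite_eq', Finset.mem_univ,
      if_true]
    ring
  simp only [riemannTensor, Finset.sum_sub_distrib, hq, pderiv_christoffel hx,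
    kleinMetric_symm x j i]
  ring

lemma sectionalForm_kleinMetric {x : E d} (hx : x ∈ unitBall d) (X Y : E d) :
    sectionalForm kleinMetric x X Y =
      metricForm kleinMetric x X Y ^ 2 -
        metricForm kleinMetric x X X * metricForm kleinMetric x Y Y := by
  have hs : metricForm kleinMetric x Y X = metricForm kleinMetric x X Y := by
    simp only [metricForm_kleinMetric, real_inner_comm, mul_comm]
  have key : ∀ i j k, ∑ l, ∑ s, kleinMetric x l s * riemannTensor kleinMetric l k i j x *
      X i * Y j * Y k * X s =
      (kleinMetric x i k * X i * Y k) * (∑ s, kleinMetric x j s * Y j * X s) -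
      (∑ s, kleinMetric x i s * X i * X s) * (kleinMetric x j k * Y j * Y k) := by
    intro i j k
    rw [Finset.sum_comm]
    simp only [Finset.mul_sum, Finset.sum_mul, ← Finset.sum_sub_distrib]
    refine Finset.sum_congr rfl fun s _ => ?_
    have h : ∀ l, kleinMetric x l s * riemannTensor kleinMetric l k i j x * X i * Y j * Y k * X s =
      (if l = j then kleinMetric x l s * kleinMetric x i k * X i * Y j * Y k * X s else 0) -
      (if l = i then kleinMetric x l s * kleinMetric x j k * X i * Y j * Y k * X s else 0) := by
      intro l
      rw [riemannTensor_kleinMetric hx]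
      split_ifs <;> ring
    simp only [h, Finset.sum_sub_distrib, Finset.sum_ite_eq', Finset.mem_univ, if_true]
    ring
  simp only [sectionalForm, key, Finset.sum_sub_distrib, ← Finset.mul_sum, ← Finset.sum_mul]
  rw [sq]
  nth_rewrite 1 [← hs]
  simp only [metricForm]
  ring

lemma sectionalForm_nonpos {x : E d} (hx : x ∈ unitBall d) (X Y : E d) :
    sectionalForm kleinMetric x X Y ≤ 0 := by
  rw [sectionalForm_kleinMetric hx, metricForm_self_kleinMetric, metricForm_self_kleinMetric,
    metricForm_kleinMetric]
  have hw := one_sub_norm_sq_pos hx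
  set w := 1 - ‖x‖ ^ 2
  set a := inner ℝ x X
  set b := inner ℝ x Y
  have h1 : inner ℝ X Y ^ 2 ≤ ‖X‖ ^ 2 * ‖Y‖ ^ 2 := by
    rw [← mul_pow]
    exact sq_le_sq.2 ((abs_real_inner_le_norm X Y).trans (le_abs_self _))
  -- The Gram determinant of $g$ is the Euclidean one over $w^2$ plus $|bX-aY|^2/w^3$, so it is
  -- nonnegative.
  have h2 := real_inner_self_nonneg (x := b • X - a • Y)
  rw [inner_sub_left, inner_sub_right, inner_sub_right, real_inner_smul_left,
    real_inner_smul_left, real_inner_smul_left, real_inner_smul_left, real_inner_smul_right,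
    real_inner_smul_right, real_inner_smul_right, real_inner_smul_right,
    real_inner_self_eq_norm_sq, real_inner_self_eq_norm_sq, real_inner_comm X Y] at h2
  have e : (inner ℝ X Y / w + a * b / w ^ 2) ^ 2 - (‖X‖ ^ 2 / w + (a / w) ^ 2) *
      (‖Y‖ ^ 2 / w + (b / w) ^ 2) = -((‖X‖ ^ 2 * ‖Y‖ ^ 2 - inner ℝ X Y ^ 2) / w ^ 2 +
        (b ^ 2 * ‖X‖ ^ 2 - 2 * (a * b) * inner ℝ X Y + a ^ 2 * ‖Y‖ ^ 2) / w ^ 3) := by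
    field_simp
    ring
  rw [e, neg_nonpos]
  refine add_nonneg (div_nonneg (by linarith) (by positivity)) (div_nonneg (by linarith)
    (by positivity))

/-! ### Completeness -/

lemma IsPiecewiseSmoothCurve.exists_differentiableAt {Ω : Set (E d)} {x y : E d} {γ : ℝ → E d}
    (hγ : IsPiecewiseSmoothCurve Ω x y γ) :
    ∃ S : Finset ℝ, ∀ t ∈ Ioo (0 : ℝ) 1 \ S, DifferentiableAt ℝ γ t := by
  obtain ⟨S, hS⟩ := hγ.piecewise
  refine ⟨S, fun t ht => ?_⟩
  have ho : Ioo (0 : ℝ) 1 \ S ∈ 𝓝 t := (isOpen_Ioo.sdiff S.finite_toSet.isClosed).mem_nhds ht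
  obtain ⟨ε, hε, hb⟩ := Metric.mem_nhds_iff.1 ho
  rw [Real.ball_eq_Ioo] at hb
  have hab : t - ε / 2 < t + ε / 2 := by linarith
  have hsub : Icc (t - ε / 2) (t + ε / 2) ⊆ Ioo (0 : ℝ) 1 \ S :=
    (Icc_subset_Ioo (by linarith) (by linarith)).trans hb
  have h1 := hsub (left_mem_Icc.2 hab.le)
  have h2 := hsub (right_mem_Icc.2 hab.le)
  refine ((hS _ _ h1.1.1.le hab h2.1.2.le fun s hs hs' =>
    (hsub (Ioo_subset_Icc_self hs')).2 hs).differentiableOn (by simp)).differentiableAt ?_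
  exact Icc_mem_nhds (by linarith) (by linarith)

/-- A function whose differential is dominated by $F$ varies along a curve by at most its length:
the fundamental theorem of calculus holds off the finitely many break points. Finite length supplies
the integrability of the derivative; infinite length is trivial. -/
lemma enorm_sub_le_curveLength {G : Type*} [NormedAddCommGroup G] [NormedSpace ℝ G]
    [CompleteSpace G] [SecondCountableTopology G] {Ω : Set (E d)} (hΩ : IsOpen Ω)
    {F : E d → E d → ℝ} {f : E d → G} (hf : DifferentiableOn ℝ f Ω)
    (hF : ∀ z ∈ Ω, ∀ v, ‖fderiv ℝ f z v‖ ≤ F z v) {x y : E d} {γ : ℝ → E d}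
    (hγ : IsPiecewiseSmoothCurve Ω x y γ) : ‖f y - f x‖ₑ ≤ curveLength F γ := by
  rcases eq_or_ne (curveLength F γ) ⊤ with htop | htop
  · rw [htop]; exact le_top
  obtain ⟨S, hS⟩ := hγ.exists_differentiableAt
  have hd : ∀ t ∈ Ioo (0 : ℝ) 1 \ S,
      HasDerivAt (f ∘ γ) (fderiv ℝ f (γ t) (deriv γ t)) t := fun t ht =>
    ((hf.differentiableAt (hΩ.mem_nhds (hγ.mapsTo
      (Ioo_subset_Icc_self ht.1)))).hasFDerivAt).comp_hasDerivAt t (hS t ht).hasDerivAt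
  have hle : ∫⁻ t in Ioc (0 : ℝ) 1, ‖deriv (f ∘ γ) t‖ₑ ≤ curveLength F γ := by
    rw [← restrict_Ioo_eq_restrict_Ioc, curveLength, ← restrict_Ioo_eq_restrict_Icc]
    refine lintegral_mono_ae ?_
    have hS0 : ∀ᵐ t ∂(volume.restrict (Ioo (0 : ℝ) 1)), t ∉ (S : Set ℝ) :=
      ae_restrict_of_ae (S.countable_toSet.ae_notMem volume)
    filter_upwards [hS0, ae_restrict_mem measurableSet_Ioo] with t ht ht'
    rw [(hd t ⟨ht', ht⟩).deriv, ← ofReal_norm]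
    exact ENNReal.ofReal_le_ofReal (hF _ (hγ.mapsTo (Ioo_subset_Icc_self ht')) _)
  have hint : IntervalIntegrable (deriv (f ∘ γ)) volume 0 1 := by
    rw [intervalIntegrable_iff_integrableOn_Ioc_of_le zero_le_one]
    exact ⟨(stronglyMeasurable_deriv _).aestronglyMeasurable, hle.trans_lt htop.lt_top⟩
  have hftc := integral_eq_of_hasDerivAt_off_countable_of_le (f ∘ γ) (deriv (f ∘ γ)) zero_le_one
    S.countable_toSet (hf.continuousOn.comp hγ.continuousOn hγ.mapsTo)
    (fun t ht => by rw [(hd t ht).deriv]; exact hd t ht) hint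
  simp only [Function.comp_apply, hγ.source, hγ.target] at hftc
  rw [← hftc, intervalIntegral.integral_of_le zero_le_one]
  exact (enorm_integral_le_lintegral_enorm _).trans hle

lemma enorm_sub_le_riemannianDist {G : Type*} [NormedAddCommGroup G] [NormedSpace ℝ G]
    [CompleteSpace G] [SecondCountableTopology G] {f : E d → G}
    (hf : DifferentiableOn ℝ f (unitBall d))
    (hF : ∀ z ∈ unitBall d, ∀ v, ‖fderiv ℝ f z v‖ ^ 2 ≤ metricForm kleinMetric z v v)
    (x y : E d) : ‖f y - f x‖ₑ ≤ riemannianDist (unitBall d) kleinMetric x y :=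
  le_iInf₂ fun _ hγ => enorm_sub_le_curveLength isOpen_unitBall hf
    (fun z hz v => Real.le_sqrt_of_sq_le (hF z hz v)) hγ

lemma enorm_sub_le_riemannianDist_kleinMetric (x y : E d) :
    ‖y - x‖ₑ ≤ riemannianDist (unitBall d) kleinMetric x y := by
  refine enorm_sub_le_riemannianDist (f := fun z : E d => z) differentiableOn_id
    (fun z hz v => ?_) x y
  have hw := one_sub_norm_sq_pos hz
  rw [fderiv_fun_id, metricForm_self_kleinMetric, ContinuousLinearMap.id_apply]
  have : ‖v‖ ^ 2 ≤ ‖v‖ ^ 2 / (1 - ‖z‖ ^ 2) :=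
    le_div_self (sq_nonneg _) hw (by nlinarith [sq_nonneg ‖z‖])
  nlinarith [sq_nonneg (inner ℝ z v / (1 - ‖z‖ ^ 2))]

/-- The differential of $\tfrac12\log w$ is $-\beta$, and $\beta_x(v)^2$ is one of the two summands
of $g_x(v,v)$. This function is unbounded at the sphere, so bounded distance forces a positive
Euclidean gap. -/
lemma enorm_log_sub_log_le_riemannianDist (x y : E d) :
    ‖Real.log (1 - ‖y‖ ^ 2) / 2 - Real.log (1 - ‖x‖ ^ 2) / 2‖ₑ ≤
      riemannianDist (unitBall d) kleinMetric x y := by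
  have hd : ∀ z ∈ unitBall d, HasFDerivAt (fun z : E d => Real.log (1 - ‖z‖ ^ 2) / 2)
      ((-(1 - ‖z‖ ^ 2)⁻¹) • innerSL ℝ z) z := fun z hz => by
    have hN : HasFDerivAt (fun z : E d => 1 - ‖z‖ ^ 2) (-(2 • innerSL ℝ z)) z :=
      (hasStrictFDerivAt_norm_sq z).hasFDerivAt.const_sub 1
    have h := (hN.log (one_sub_norm_sq_pos hz).ne').const_mul (1 / 2)
    refine (h.congr_of_eventuallyEq (.of_forall fun z => by ring)).congr_fderiv ?_
    rw [← Nat.cast_smul_eq_nsmul ℝ, smul_neg, smul_neg, neg_smul, smul_smul, smul_smul]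
    congr 2
    push_cast
    ring
  refine enorm_sub_le_riemannianDist (f := fun z : E d => Real.log (1 - ‖z‖ ^ 2) / 2)
    (fun z hz => (hd z hz).differentiableAt.differentiableWithinAt) (fun z hz v => ?_) x y
  have hw := one_sub_norm_sq_pos hz
  rw [(hd z hz).fderiv, metricForm_self_kleinMetric]
  have : ‖((-(1 - ‖z‖ ^ 2)⁻¹) • innerSL ℝ z) v‖ ^ 2 = (inner ℝ z v / (1 - ‖z‖ ^ 2)) ^ 2 := by
    rw [Real.norm_eq_abs, sq_abs, _root_.smul_apply, innerSL_apply_apply, smul_eq_mul]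
    ring
  rw [this]
  have : 0 ≤ ‖v‖ ^ 2 / (1 - ‖z‖ ^ 2) := by positivity
  linarith

lemma metricForm_self_le {x : E d} (hx : x ∈ unitBall d) (y : E d) :
    metricForm kleinMetric x y y ≤ (‖y‖ / (1 - ‖x‖ ^ 2)) ^ 2 := by
  have hw := one_sub_norm_sq_pos hx
  rw [metricForm_self_kleinMetric]
  have h : inner ℝ x y ^ 2 ≤ ‖x‖ ^ 2 * ‖y‖ ^ 2 := by
    rw [← mul_pow]
    exact sq_le_sq.2 ((abs_real_inner_le_norm x y).trans (le_abs_self _))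
  rw [div_pow, div_pow, ← sub_nonneg]
  have e : ‖y‖ ^ 2 / (1 - ‖x‖ ^ 2) ^ 2 - (‖y‖ ^ 2 / (1 - ‖x‖ ^ 2) +
      inner ℝ x y ^ 2 / (1 - ‖x‖ ^ 2) ^ 2) =
      (‖x‖ ^ 2 * ‖y‖ ^ 2 - inner ℝ x y ^ 2) / (1 - ‖x‖ ^ 2) ^ 2 := by
    field_simp
    ring
  rw [e]
  exact div_nonneg (by linarith) (by positivity)

/-- The straight segment stays in the ball of radius $R$, where $\sqrt g$ is at most $(1-R^2)^{-1}$
times the Euclidean norm. -/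
lemma riemannianDist_kleinMetric_le {R : ℝ} (hR : R < 1) {x y : E d} (hx : ‖x‖ ≤ R)
    (hy : ‖y‖ ≤ R) :
    riemannianDist (unitBall d) kleinMetric x y ≤ ENNReal.ofReal (‖y - x‖ / (1 - R ^ 2)) := by
  have hR0 : 0 ≤ R := (norm_nonneg x).trans hx
  have hmem : ∀ t ∈ Icc (0 : ℝ) 1, ‖x + t • (y - x)‖ ≤ R := fun t ht => by
    have := (convex_closedBall (0 : E d) R).add_smul_sub_mem (x := x) (y := y)
      (by simpa using hx) (by simpa using hy) ht
    simpa using this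
  have hc : ContDiff ℝ ∞ (fun t : ℝ => x + t • (y - x)) := by fun_prop
  have hγ : IsPiecewiseSmoothCurve (unitBall d) x y (fun t : ℝ => x + t • (y - x)) :=
    { mapsTo := fun t ht => mem_unitBall.2 ((hmem t ht).trans_lt hR)
      source := by simp
      target := by simp
      continuousOn := hc.continuous.continuousOn
      piecewise := ⟨∅, fun a b _ _ _ _ => hc.contDiffOn⟩ }
  refine (iInf₂_le _ hγ).trans ?_
  have hder : ∀ t : ℝ, deriv (fun t : ℝ => x + t • (y - x)) t = y - x := fun t => by
    have := ((hasDerivAt_id t).smul_const (y - x)).const_add x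
    simpa using this.deriv
  calc curveLength _ _ ≤ ∫⁻ _ in Icc (0 : ℝ) 1, ENNReal.ofReal (‖y - x‖ / (1 - R ^ 2)) := by
        refine setLIntegral_mono measurable_const fun t ht => ENNReal.ofReal_le_ofReal ?_
        rw [hder]
        have hz : x + t • (y - x) ∈ unitBall d := mem_unitBall.2 ((hmem t ht).trans_lt hR)
        have hw := one_sub_norm_sq_pos hz
        refine (Real.sqrt_le_sqrt (metricForm_self_le hz _)).trans ?_
        rw [Real.sqrt_sq (by positivity)]
        refine div_le_div_of_nonneg_left (norm_nonneg _) (by nlinarith) ?_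
        have := hmem t ht
        have := norm_nonneg (x + t • (y - x))
        nlinarith
    _ = _ := by simp

lemma complete_kleinMetric (s : ℕ → E d) (hs : ∀ n, s n ∈ unitBall d)
    (hc : ∀ ε : ℝ≥0∞, 0 < ε → ∃ N, ∀ m ≥ N, ∀ n ≥ N,
      riemannianDist (unitBall d) kleinMetric (s m) (s n) < ε) :
    ∃ x ∈ unitBall d,
      Tendsto (fun n => riemannianDist (unitBall d) kleinMetric (s n) x) atTop (𝓝 0) := by
  obtain ⟨N, hN⟩ := hc 1 one_pos
  -- Beyond $N$ the distance to `s N` is below $1$, so $\tfrac12\log(1-|s_n|^2)$ drops by less than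
  -- $1$; hence the $2$.
  set c := Real.exp (Real.log (1 - ‖s N‖ ^ 2) - 2) with hcdef
  have hc0 : 0 < c := Real.exp_pos _
  have hbound : ∀ n ≥ N, c ≤ 1 - ‖s n‖ ^ 2 := fun n hn => by
    have h := (enorm_log_sub_log_le_riemannianDist (s N) (s n)).trans_lt (hN N le_rfl n hn)
    rw [← ofReal_norm, ENNReal.ofReal_lt_one, Real.norm_eq_abs, abs_lt] at h
    rw [hcdef, ← Real.le_log_iff_exp_le (one_sub_norm_sq_pos (hs n))]
    linarith [h.1]
  have hcauchy : CauchySeq s := by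
    rw [Metric.cauchySeq_iff]
    intro ε hε
    obtain ⟨M, hM⟩ := hc (ENNReal.ofReal ε) (ENNReal.ofReal_pos.2 hε)
    refine ⟨M, fun m hm n hn => ?_⟩
    have h := (enorm_sub_le_riemannianDist_kleinMetric (s n) (s m)).trans_lt (hM n hn m hm)
    rw [← ofReal_norm] at h
    rw [dist_eq_norm]
    exact (ENNReal.ofReal_lt_ofReal_iff hε).1 h
  obtain ⟨x, hx⟩ := cauchySeq_tendsto_of_complete hcauchy
  set R := Real.sqrt (1 - c) with hRdef
  have hR : R < 1 := by
    rw [hRdef, Real.sqrt_lt' one_pos]; linarith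
  have hsR : ∀ n ≥ N, ‖s n‖ ≤ R := fun n hn => Real.le_sqrt_of_sq_le (by linarith [hbound n hn])
  have hxR : ‖x‖ ≤ R := le_of_tendsto hx.norm ((eventually_ge_atTop N).mono hsR)
  refine ⟨x, mem_unitBall.2 (hxR.trans_lt hR), ?_⟩
  have hlim : Tendsto (fun n => ENNReal.ofReal (‖x - s n‖ / (1 - R ^ 2))) atTop (𝓝 0) := by
    have : Tendsto (fun n => ‖x - s n‖ / (1 - R ^ 2)) atTop (𝓝 0) := by
      simpa using ((tendsto_const_nhds (x := x)).sub hx).norm.div_const (1 - R ^ 2)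
    simpa using ENNReal.tendsto_ofReal this
  exact tendsto_of_tendsto_of_tendsto_of_le_of_le' tendsto_const_nhds hlim
    (.of_forall fun _ => zero_le) ((eventually_ge_atTop N).mono fun n hn =>
      riemannianDist_kleinMetric_le hR (hsR n hn) hxR)

lemma isHadamard_kleinMetric : IsHadamard (unitBall d) kleinMetric where
  metric := isRiemannianMetric_kleinMetric
  simplyConnected := by
    have : ContractibleSpace (unitBall d) :=
      (convex_ball (0 : E d) 1).contractibleSpace ⟨0, by simp⟩
    infer_instance
  complete := complete_kleinMetric
  curvature_nonpos _ hx := sectionalForm_nonpos hx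

/-! ### The polar transform of the Funk metric -/

/-- The indicatrix of $F$ at $x$ is the unit sphere translated by $-x$, that is $|F(x,y)\,x + y| =
F(x,y)$. Cauchy–Schwarz on that vector gives the bound. Only this inequality is needed, since norms
are only bounded from above. -/
lemma polarTransform_funk_le {x : E d} (hx : x ∈ unitBall d) (α : Fin d → ℝ) :
    polarTransform (randersMetric kleinMetric funkForm) x α ≤
      ENNReal.ofReal (‖(WithLp.toLp 2 α : E d)‖ - inner ℝ (WithLp.toLp 2 α : E d) x) := by
  have hw := one_sub_norm_sq_pos hx
  refine iSup₂_le fun y hy => ENNReal.ofReal_le_ofReal ?_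
  have hαy : ∑ i, α i * y i = inner ℝ (WithLp.toLp 2 α : E d) y := by rw [inner_eq_sum]
  rw [hαy, randersMetric, sum_funkForm_mul]
  set a : E d := WithLp.toLp 2 α
  set b := inner ℝ x y / (1 - ‖x‖ ^ 2) with hb
  set s := Real.sqrt (metricForm kleinMetric x y y) with hs
  have hs2 : s ^ 2 = ‖y‖ ^ 2 / (1 - ‖x‖ ^ 2) + b ^ 2 := by
    rw [hs, Real.sq_sqrt (metricForm_self_pos hx hy).le, metricForm_self_kleinMetric]
  have hys : 0 < ‖y‖ ^ 2 / (1 - ‖x‖ ^ 2) := by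
    have := norm_pos_iff.2 hy
    positivity
  have hsb : |b| < s := abs_lt_of_sq_lt_sq (by linarith) (Real.sqrt_nonneg _)
  have hF : 0 < s + b := by linarith [(abs_lt.1 hsb).1]
  rw [div_le_iff₀ hF]
  have hn : ‖(s + b) • x + y‖ = s + b := by
    rw [← sq_eq_sq₀ (norm_nonneg _) hF.le, norm_add_sq_real, norm_smul, Real.norm_of_nonneg hF.le,
      real_inner_smul_left]
    have h1 : inner ℝ x y = b * (1 - ‖x‖ ^ 2) := by rw [hb]; field_simp
    have h2 : ‖y‖ ^ 2 = (s ^ 2 - b ^ 2) * (1 - ‖x‖ ^ 2) := by rw [hs2]; field_simp; ring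
    rw [h1, h2]
    ring
  have h := real_inner_le_norm a ((s + b) • x + y)
  rw [hn, inner_add_right, real_inner_smul_right] at h
  linarith

/-! ### Weak derivatives of locally Lipschitz functions -/

lemma exists_subset_ball {x : E d} (hx : x ∈ unitBall d) : ∃ R < 1, x ∈ Metric.ball (0 : E d) R := by
  obtain ⟨R, h1, h2⟩ := exists_between (mem_unitBall.1 hx)
  exact ⟨R, h2, by simpa using h1⟩

lemma continuousOn_of_lipschitz {u : E d → ℝ}
    (hu : ∀ R < 1, ∃ K, LipschitzOnWith K u (Metric.closedBall 0 R)) :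
    ContinuousOn u (unitBall d) := fun x hx => by
  obtain ⟨R, hR, hxR⟩ := exists_subset_ball hx
  obtain ⟨K, hK⟩ := hu R hR
  exact (hK.continuousOn.continuousAt (mem_of_superset (Metric.isOpen_ball.mem_nhds hxR)
    Metric.ball_subset_closedBall)).continuousWithinAt

lemma norm_pderiv_le_of_lipschitzOn {u : E d → ℝ} {K : ℝ≥0} {R : ℝ}
    (hK : LipschitzOnWith K u (Metric.closedBall 0 R)) (i : Fin d) {x : E d}
    (hx : x ∈ Metric.ball (0 : E d) R) : ‖pderiv i u x‖ ≤ K := by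
  have h := norm_fderiv_le_of_lipschitzOn ℝ (mem_of_superset (Metric.isOpen_ball.mem_nhds hx)
    Metric.ball_subset_closedBall) hK
  refine ((fderiv ℝ u x).le_opNorm _).trans ?_
  simpa using h

lemma measurable_pderiv (u : E d → ℝ) (i : Fin d) : Measurable (pderiv i u) :=
  measurable_fderiv_apply_const ℝ u _

/-- The classical gradient, which exists almost everywhere by Rademacher, is the weak one. Only the
values of $u$ on a smaller ball containing the support of the test function matter, so $u$ may be
replaced by a globally Lipschitz extension from that ball. -/
lemma hasWeakDeriv_of_lipschitz {u : E d → ℝ}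
    (hu : ∀ R < 1, ∃ K, LipschitzOnWith K u (Metric.closedBall 0 R)) :
    HasWeakDeriv (unitBall d) u (fun x i => pderiv i u x) where
  locallyIntegrable :=
    (continuousOn_of_lipschitz hu).locallyIntegrableOn isOpen_unitBall.measurableSet
  locallyIntegrable_deriv i x hx := by
    obtain ⟨R, hR, hxR⟩ := exists_subset_ball hx
    obtain ⟨K, hK⟩ := hu R hR
    refine ⟨Metric.ball 0 R, mem_nhdsWithin_of_mem_nhds (Metric.isOpen_ball.mem_nhds hxR), ?_⟩
    refine Measure.integrableOn_of_bounded (M := K) measure_ball_lt_top.ne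
      (measurable_pderiv u i).aestronglyMeasurable ?_
    filter_upwards [ae_restrict_mem Metric.isOpen_ball.measurableSet] with z hz
    exact norm_pderiv_le_of_lipschitzOn hK i hz
  integral_eq φ hφ hφc hφs i := by
    obtain ⟨R, hR, hsub⟩ := exists_lt_subset_ball (isClosed_tsupport φ) hφs
    obtain ⟨K, hK⟩ := hu R hR
    obtain ⟨g, hg, hgu⟩ := hK.extend_real
    obtain ⟨C, hC⟩ := ContDiff.lipschitzWith_of_hasCompactSupport hφc hφ (by simp)
    have h0 : ∀ x ∉ Metric.ball (0 : E d) R, φ x = 0 ∧ pderiv i φ x = 0 := fun x hx =>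
      ⟨image_eq_zero_of_notMem_tsupport fun h => hx (hsub h), by
        rw [pderiv, fderiv_of_notMem_tsupport ℝ fun h => hx (hsub h)]; rfl⟩
    have hball : Metric.ball (0 : E d) R ⊆ unitBall d := Metric.ball_subset_ball hR.le
    rw [setIntegral_eq_integral_of_forall_compl_eq_zero fun x hx => by
        rw [(h0 x fun h => hx (hball h)).2, mul_zero],
      setIntegral_eq_integral_of_forall_compl_eq_zero fun x hx => by
        rw [(h0 x fun h => hx (hball h)).1, mul_zero]]
    have key := hg.integral_lineDeriv_mul_eq (μ := volume) hC hφc (EuclideanSpace.single i (1 : ℝ))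
    have h1 : ∫ x, pderiv i u x * φ x = ∫ x, lineDeriv ℝ g x (EuclideanSpace.single i 1) * φ x := by
      refine integral_congr_ae ?_
      filter_upwards [hg.ae_differentiableAt (μ := volume)] with x hx
      by_cases hxR : x ∈ Metric.ball (0 : E d) R
      · have : u =ᶠ[𝓝 x] g := by
          filter_upwards [Metric.isOpen_ball.mem_nhds hxR] with z hz
          exact hgu (Metric.ball_subset_closedBall hz)
        simp only [pderiv, this.fderiv_eq, hx.lineDeriv_eq_fderiv]
      · simp only [(h0 x hxR).1, mul_zero]
    have h2 : ∫ x, u x * pderiv i φ x =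
        - ∫ x, lineDeriv ℝ φ x (-EuclideanSpace.single i 1) * g x := by
      rw [← integral_neg]
      refine integral_congr_ae (.of_forall fun x => ?_)
      simp only
      rw [((hφ.differentiable (by simp)) x).lineDeriv_eq_fderiv, map_neg, neg_mul, neg_neg, mul_comm]
      by_cases hxR : x ∈ Metric.ball (0 : E d) R
      · rw [hgu (Metric.ball_subset_closedBall hxR)]; rfl
      · have := (h0 x hxR).2
        rw [this, zero_mul]
        rw [pderiv] at this
        rw [this, zero_mul]
    rw [h1, h2, key]

lemma memSobolevLoc_of_lipschitz {u : E d → ℝ}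
    (hu : ∀ R < 1, ∃ K, LipschitzOnWith K u (Metric.closedBall 0 R)) (p : ℝ) :
    MemSobolevLoc (unitBall d) p u := by
  refine ⟨_, hasWeakDeriv_of_lipschitz hu, fun K hKs hK => ?_⟩
  have : IsFiniteMeasure (volume.restrict K) := ⟨by simpa using hK.measure_lt_top⟩
  have hc := (continuousOn_of_lipschitz hu).mono hKs
  obtain ⟨R, hR, hsub⟩ := exists_lt_subset_ball hK.isClosed hKs
  obtain ⟨L, hL⟩ := hu R hR
  obtain ⟨C, hC⟩ := hK.exists_bound_of_continuousOn hc
  refine ⟨.of_bound (hc.aestronglyMeasurable hK.measurableSet) C ?_, fun i =>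
    .of_bound (measurable_pderiv u i).aestronglyMeasurable L ?_⟩
  · filter_upwards [ae_restrict_mem hK.measurableSet] with x hx using hC x hx
  · filter_upwards [ae_restrict_mem hK.measurableSet] with x hx
    exact norm_pderiv_le_of_lipschitzOn hL i (hsub hx)

/-! ### Radial functions -/

lemma lipschitzOnWith_radial {k : ℝ → ℝ} (hk : ContDiffOn ℝ ∞ k (Iio 1)) (R : ℝ) (hR : R < 1) :
    ∃ K, LipschitzOnWith K (fun x : E d => k ‖x‖) (Metric.closedBall 0 R) := by
  obtain ⟨K, hK⟩ := (hk.mono fun s (hs : s ∈ Icc 0 R) => hs.2.trans_lt hR).exists_lipschitzOnWith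
    (by simp) (convex_Icc 0 R) isCompact_Icc
  have := hK.comp (lipschitzWith_one_norm.lipschitzOnWith (s := Metric.closedBall (0 : E d) R))
    fun x hx => ⟨norm_nonneg x, by simpa using hx⟩
  exact ⟨_, this⟩

lemma hasFDerivAt_radial {k : ℝ → ℝ} (hk : ContDiffOn ℝ ∞ k (Iio 1)) {x : E d}
    (hx : x ∈ unitBall d) (hx0 : x ≠ 0) :
    HasFDerivAt (fun x : E d => k ‖x‖) ((deriv k ‖x‖ * ‖x‖⁻¹) • innerSL ℝ x) x := by
  have hk' : HasDerivAt k (deriv k ‖x‖) ‖x‖ :=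
    ((hk.contDiffAt (isOpen_Iio.mem_nhds (mem_unitBall.1 hx))).differentiableAt
      (by simp)).hasDerivAt
  have hN : HasFDerivAt (fun z : E d => ‖z‖) (‖x‖⁻¹ • innerSL ℝ x) x := by
    have h := ((hasStrictFDerivAt_norm_sq x).hasFDerivAt).sqrt (pow_ne_zero 2 (norm_ne_zero_iff.2 hx0))
    simp only [Real.sqrt_sq (norm_nonneg _)] at h
    refine h.congr_fderiv ?_
    rw [← Nat.cast_smul_eq_nsmul ℝ, smul_smul]
    congr 1
    push_cast
    ring
  refine (hk'.comp_hasFDerivAt x hN).congr_fderiv ?_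
  rw [smul_smul]

lemma polarTransform_radial_le {k : ℝ → ℝ} (hk : ContDiffOn ℝ ∞ k (Iio 1)) {x : E d}
    (hx : x ∈ unitBall d) (hx0 : x ≠ 0) :
    polarTransform (randersMetric kleinMetric funkForm) x
      (fun i => pderiv i (fun x : E d => k ‖x‖) x) ≤
      ENNReal.ofReal (|deriv k ‖x‖| - deriv k ‖x‖ * ‖x‖) := by
  refine (polarTransform_funk_le hx _).trans_eq ?_
  have h : (WithLp.toLp 2 (fun i => pderiv i (fun x : E d => k ‖x‖) x) : E d) =
      (deriv k ‖x‖ * ‖x‖⁻¹) • x := by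
    ext i
    simp only [pderiv, (hasFDerivAt_radial hk hx hx0).fderiv]
    rw [_root_.smul_apply, innerSL_single]
    rfl
  have hx' := norm_ne_zero_iff.2 hx0
  rw [h, norm_smul, real_inner_smul_left, real_inner_self_eq_norm_sq, norm_mul, norm_inv,
    norm_norm, Real.norm_eq_abs]
  congr 1
  field_simp

/-- The infimum over weak derivatives is bounded by its value at the classical gradient. The origin,
where $|x|$ is not differentiable, is a null set. -/
lemma sobolevNorm_radial_le (hd : 2 ≤ d) {k : ℝ → ℝ} (hk : ContDiffOn ℝ ∞ k (Iio 1)) {p : ℝ}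
    (hp : 0 < p) {A B : E d → ℝ≥0∞}
    (hA : ∀ x ∈ unitBall d, ENNReal.ofReal (|deriv k ‖x‖| - deriv k ‖x‖ * ‖x‖) ^ p ≤ A x)
    (hB : ∀ x ∈ unitBall d, ‖k ‖x‖‖ₑ ^ p ≤ B x) :
    sobolevNorm (unitBall d) kleinMetric funkForm p (fun x : E d => k ‖x‖) ≤
      ((∫⁻ x in unitBall d, A x) + ∫⁻ x in unitBall d, B x) ^ (1 / p) := by
  refine (iInf₂_le _ (hasWeakDeriv_of_lipschitz (lipschitzOnWith_radial hk))).trans ?_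
  rw [randersVolume_funk]
  have : Nonempty (Fin d) := ⟨⟨0, by omega⟩⟩
  refine ENNReal.rpow_le_rpow (add_le_add (lintegral_mono_ae ?_) (lintegral_mono_ae ?_))
    (by positivity)
  · filter_upwards [ae_restrict_mem isOpen_unitBall.measurableSet,
      ae_restrict_of_ae (Measure.ae_ne volume (0 : E d))] with x hx hx0
    exact (ENNReal.rpow_le_rpow (polarTransform_radial_le hk hx hx0) hp.le).trans (hA x hx)
  · filter_upwards [ae_restrict_mem isOpen_unitBall.measurableSet] with x hx using hB x hx

/-! ### The profile of the extremal function -/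

/-- The one-variable profile `s (1 - s)^(-1/t)`. -/
noncomputable def funkProfile (t s : ℝ) : ℝ := s * (1 - s) ^ (-(1 / t))

lemma funkFunction_eq (t : ℝ) : funkFunction (d := d) t = fun x => funkProfile t ‖x‖ := rfl

lemma contDiffOn_funkProfile (t : ℝ) : ContDiffOn ℝ ∞ (funkProfile t) (Iio 1) :=
  contDiffOn_id.mul ((contDiffOn_const.sub contDiffOn_id).rpow_const_of_ne
    fun _ hs => (sub_pos.2 hs).ne')

lemma hasDerivAt_funkProfile (t : ℝ) {s : ℝ} (hs : s < 1) :
    HasDerivAt (funkProfile t)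
      ((1 - s) ^ (-(1 / t)) * (1 + s / (t * (1 - s)))) s := by
  have h1 : 0 < 1 - s := sub_pos.2 hs
  have h := (hasDerivAt_id s).mul (((hasDerivAt_id s).const_sub 1).rpow_const
    (p := -(1 / t)) (.inl h1.ne'))
  refine h.congr_deriv ?_
  simp only [id]
  rw [Real.rpow_sub_one h1.ne']
  rcases eq_or_ne t 0 with rfl | ht
  · simp
  · field_simp

lemma funkProfile_nonneg (t : ℝ) {s : ℝ} (h0 : 0 ≤ s) (hs : s < 1) : 0 ≤ funkProfile t s :=
  mul_nonneg h0 (Real.rpow_nonneg (sub_pos.2 hs).le _)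

lemma funkProfile_le (t : ℝ) {s : ℝ} (hs : s < 1) :
    funkProfile t s ≤ (1 - s) ^ (-(1 / t)) :=
  mul_le_of_le_one_left (Real.rpow_nonneg (sub_pos.2 hs).le _) hs.le

/-- The derivative is positive, so the left side is $k'(s)(1-s)$, and the factor $1-s$ absorbs the
singularity gained by differentiating. -/
lemma abs_deriv_sub_funkProfile_le {t : ℝ} (ht : 0 < t) {s : ℝ} (h0 : 0 ≤ s) (hs : s < 1) :
    |deriv (funkProfile t) s| - deriv (funkProfile t) s * s ≤
      (1 + 1 / t) * (1 - s) ^ (-(1 / t)) := by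
  have h1 : 0 < 1 - s := sub_pos.2 hs
  have hr := Real.rpow_nonneg h1.le (-(1 / t))
  have hq : 0 ≤ s / (t * (1 - s)) := by positivity
  rw [(hasDerivAt_funkProfile t hs).deriv, abs_of_nonneg (by positivity)]
  have e : (1 - s) ^ (-(1 / t)) * (1 + s / (t * (1 - s))) -
      (1 - s) ^ (-(1 / t)) * (1 + s / (t * (1 - s))) * s =
      ((1 - s) + s / t) * (1 - s) ^ (-(1 / t)) := by
    field_simp
  rw [e]
  refine mul_le_mul_of_nonneg_right ?_ hr
  have : s / t ≤ 1 / t := by gcongr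
  linarith

/-! ### Radial integrals -/

lemma lintegral_one_sub_norm_rpow_lt_top (hd : 2 ≤ d) {a : ℝ} (ha : a < 1) (c : ℝ) :
    ∫⁻ x in unitBall d, ENNReal.ofReal (c * (1 - ‖x‖) ^ (-a)) < ⊤ := by
  have : Nonempty (Fin d) := ⟨⟨0, by omega⟩⟩
  have h1 : IntegrableOn (fun y : ℝ => (1 - y) ^ (-a)) (Ioo 0 1) := by
    have h := (intervalIntegral.intervalIntegrable_rpow' (a := 1) (b := 0) (r := -a)
      (by linarith)).comp_sub_left 1
    simp only [sub_self, sub_zero] at h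
    rw [intervalIntegrable_iff_integrableOn_Ioo_of_le zero_le_one] at h
    exact h
  have h2 : IntegrableOn (fun y : ℝ => y ^ (Module.finrank ℝ (E d) - 1) • (c * (1 - y) ^ (-a)))
      (Ioo 0 1) := by
    refine Integrable.bdd_mul (c := 1) (h1.const_mul c)
      (by fun_prop) ?_
    filter_upwards [ae_restrict_mem measurableSet_Ioo] with y hy
    rw [norm_pow, Real.norm_of_nonneg hy.1.le]
    exact pow_le_one₀ hy.1.le hy.2.le
  exact ((integrableOn_fun_norm_addHaar (volume : Measure (E d))
    (f := fun y => c * (1 - y) ^ (-a))).2 h2).lintegral_lt_top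

lemma lintegral_funkProfile_rpow_eq_top (hd : 2 ≤ d) {t q : ℝ} (ht : 0 < t) (hq : t ≤ q) :
    ∫⁻ x in unitBall d, ENNReal.ofReal (funkProfile t ‖x‖ ^ q) = ⊤ := by
  have : Nonempty (Fin d) := ⟨⟨0, by omega⟩⟩
  by_contra hfin
  have hm : Measurable (fun y : ℝ => funkProfile t y ^ q) := by
    unfold funkProfile; fun_prop
  have hint : IntegrableOn (fun x : E d => funkProfile t ‖x‖ ^ q) (Metric.ball 0 1) := by
    refine ⟨(hm.comp measurable_norm).aestronglyMeasurable, ?_⟩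
    rw [hasFiniteIntegral_iff_ofReal]
    · exact lt_top_iff_ne_top.2 hfin
    · filter_upwards [ae_restrict_mem isOpen_unitBall.measurableSet] with x hx
      exact Real.rpow_nonneg (funkProfile_nonneg t (norm_nonneg x) (mem_unitBall.1 hx)) _
  have h1 := ((integrableOn_fun_norm_addHaar (volume : Measure (E d))
    (f := fun y => funkProfile t y ^ q)).1 hint).mono_set (Ioo_subset_Ioo_left
      (show (0 : ℝ) ≤ 1 / 2 by norm_num))
  set n := Module.finrank ℝ (E d) - 1
  have h2 : IntegrableOn (fun y : ℝ => (y - 1)⁻¹) (Ioo (1 / 2) 1) := by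
    -- On $(1/2,1)$ the constant compensates for $y^n y^q$, since $2y\ge 1$; what remains dominates
    -- $(1-y)^{-1}$ because $q/t\ge 1$.
    refine Integrable.mono' (h1.const_mul (2 ^ n * 2 ^ q))
      (by fun_prop) ?_
    filter_upwards [ae_restrict_mem measurableSet_Ioo] with y hy
    have hy1 : 0 < 1 - y := sub_pos.2 hy.2
    have hy0 : 0 < y := by linarith [hy.1]
    rw [norm_inv, Real.norm_eq_abs, abs_sub_comm, abs_of_pos hy1, funkProfile,
      Real.mul_rpow hy0.le (Real.rpow_nonneg hy1.le _), ← Real.rpow_mul hy1.le, smul_eq_mul]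
    have e : 2 ^ n * 2 ^ q * (y ^ n * (y ^ q * (1 - y) ^ (-(1 / t) * q))) =
        (2 * y) ^ n * (2 * y) ^ q * (1 - y) ^ (-(1 / t) * q) := by
      rw [mul_pow, Real.mul_rpow zero_le_two hy0.le]; ring
    rw [e]
    have h2y : 1 ≤ 2 * y := by linarith [hy.1]
    have hA : 1 ≤ (2 * y) ^ n * (2 * y) ^ q :=
      one_le_mul_of_one_le_of_one_le (one_le_pow₀ h2y)
        (Real.one_le_rpow h2y (ht.le.trans hq))
    have hB : (1 - y)⁻¹ ≤ (1 - y) ^ (-(1 / t) * q) := by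
      rw [← Real.rpow_neg_one]
      refine Real.rpow_le_rpow_of_exponent_ge hy1 (by linarith) ?_
      have : 1 ≤ q / t := (one_le_div ht).2 hq
      have : -(1 / t) * q = -(q / t) := by ring
      linarith
    exact hB.trans (le_mul_of_one_le_left (Real.rpow_nonneg hy1.le _) hA)
  rw [← intervalIntegrable_iff_integrableOn_Ioo_of_le (by norm_num),
    intervalIntegrable_sub_inv_iff] at h2
  rcases h2 with h2 | h2
  · norm_num at h2
  · exact h2 right_mem_uIcc

lemma sobolevNorm_funkFunction_lt_top (hd : 2 ≤ d) {p t : ℝ} (hp : 0 < p) (hpt : p < t) :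
    sobolevNorm (unitBall d) kleinMetric funkForm p (funkFunction t) < ⊤ := by
  have ht : 0 < t := hp.trans hpt
  have key : ∀ c : ℝ, 0 ≤ c → ∀ x ∈ unitBall d, ∀ z ≤ c * (1 - ‖x‖) ^ (-(1 / t)),
      ENNReal.ofReal z ^ p ≤ ENNReal.ofReal (c ^ p * (1 - ‖x‖) ^ (-(p / t))) := by
    intro c hc x hx z hz
    have h1 : 0 < 1 - ‖x‖ := sub_pos.2 (mem_unitBall.1 hx)
    refine (ENNReal.rpow_le_rpow (ENNReal.ofReal_le_ofReal hz) hp.le).trans_eq ?_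
    rw [ENNReal.ofReal_rpow_of_nonneg (by positivity) hp.le, Real.mul_rpow hc (by positivity),
      ← Real.rpow_mul h1.le]
    congr 3
    ring
  rw [funkFunction_eq]
  refine (sobolevNorm_radial_le hd (contDiffOn_funkProfile t) hp
    (A := fun x => ENNReal.ofReal ((1 + 1 / t) ^ p * (1 - ‖x‖) ^ (-(p / t))))
    (B := fun x => ENNReal.ofReal (1 ^ p * (1 - ‖x‖) ^ (-(p / t))))
    (fun x hx => key _ (by positivity) x hx _
      (abs_deriv_sub_funkProfile_le ht (norm_nonneg x) (mem_unitBall.1 hx)))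
    (fun x hx => ?_)).trans_lt ?_
  · rw [Real.enorm_of_nonneg (funkProfile_nonneg t (norm_nonneg x) (mem_unitBall.1 hx))]
    exact key 1 zero_le_one x hx _ (by rw [one_mul]; exact funkProfile_le t (mem_unitBall.1 hx))
  · have h := (div_lt_one ht).2 hpt
    exact ENNReal.rpow_lt_top_of_nonneg (by positivity) (ENNReal.add_ne_top.2
      ⟨(lintegral_one_sub_norm_rpow_lt_top hd h _).ne,
        (lintegral_one_sub_norm_rpow_lt_top hd h _).ne⟩)

lemma eLpNorm_funkFunction_eq_top (hd : 2 ≤ d) {t : ℝ} (ht : 0 < t) {q : ℝ≥0∞}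
    (hq : ENNReal.ofReal t ≤ q) :
    eLpNorm (funkFunction t) q (randersVolume (unitBall d) kleinMetric funkForm) = ⊤ := by
  rw [randersVolume_funk, funkFunction_eq]
  have hq0 : q ≠ 0 := (lt_of_lt_of_le (ENNReal.ofReal_pos.2 ht) hq).ne'
  rcases eq_or_ne q ⊤ with rfl | hqt
  · rw [eLpNorm_exponent_top, eLpNormEssSup, ← not_ne_iff]
    intro hfin
    set M := (essSup (fun x : E d => ‖funkProfile t ‖x‖‖ₑ)
      (volume.restrict (unitBall d))).toReal with hM
    have hae : ∀ᵐ x ∂(volume.restrict (unitBall d)), ‖funkProfile t ‖x‖‖ ≤ M := by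
      filter_upwards [enorm_ae_le_eLpNormEssSup (fun x : E d => funkProfile t ‖x‖)
        (volume.restrict (unitBall d))] with x hx
      rw [← toReal_enorm]
      exact ENNReal.toReal_mono hfin hx
    -- An essentially bounded $u$ would have integrable $t$-th power on the ball, so the borderline
    -- exponent $q=t$ settles $q=\infty$.
    have htop := lintegral_funkProfile_rpow_eq_top hd ht le_rfl
    refine absurd htop (ne_of_lt ?_)
    calc _ ≤ ∫⁻ _ in unitBall d, ENNReal.ofReal (M ^ t) := by
          refine lintegral_mono_ae ?_
          filter_upwards [hae, ae_restrict_mem isOpen_unitBall.measurableSet] with x hx hx'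
          have h0 := funkProfile_nonneg t (norm_nonneg x) (mem_unitBall.1 hx')
          rw [Real.norm_of_nonneg h0] at hx
          exact ENNReal.ofReal_le_ofReal (Real.rpow_le_rpow h0 hx ht.le)
      _ < ⊤ := by
          rw [setLIntegral_const]
          exact ENNReal.mul_lt_top ENNReal.ofReal_lt_top measure_ball_lt_top
  · have htq : t ≤ q.toReal := (ENNReal.ofReal_le_iff_le_toReal hqt).1 hq
    have h0 : 0 < q.toReal := ht.trans_le htq
    rw [eLpNorm_eq_lintegral_rpow_enorm_toReal hq0 hqt, ENNReal.rpow_eq_top_iff_of_pos (by positivity),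
      ← lintegral_funkProfile_rpow_eq_top hd ht htq]
    refine setLIntegral_congr_fun isOpen_unitBall.measurableSet fun x hx => ?_
    have := funkProfile_nonneg t (norm_nonneg x) (mem_unitBall.1 hx)
    rw [Real.enorm_of_nonneg this, ENNReal.ofReal_rpow_of_nonneg this h0.le]

/-! ### Approximation by smooth functions -/

/-- The profile, cut off near the origin. -/
noncomputable def cutProfile (t δ s : ℝ) : ℝ := funkProfile t s * Real.smoothTransition (s / δ - 1)

lemma contDiff_smoothTransition_div (δ : ℝ) :
    ContDiff ℝ ∞ (fun s : ℝ => Real.smoothTransition (s / δ - 1)) :=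
  Real.smoothTransition.contDiff.comp ((contDiff_id.div_const δ).sub contDiff_const)

lemma contDiffOn_cutProfile (t δ : ℝ) : ContDiffOn ℝ ∞ (cutProfile t δ) (Iio 1) :=
  (contDiffOn_funkProfile t).mul (contDiff_smoothTransition_div δ).contDiffOn

lemma contDiffOn_cutProfile_norm (t : ℝ) {δ : ℝ} (hδ : 0 < δ) :
    ContDiffOn ℝ ∞ (fun x : E d => cutProfile t δ ‖x‖) (unitBall d) := by
  intro x hx
  refine ContDiffAt.contDiffWithinAt ?_
  rcases eq_or_ne x 0 with rfl | hx0
  · refine (contDiffAt_const (c := (0 : ℝ))).congr_of_eventuallyEq ?_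
    filter_upwards [Metric.ball_mem_nhds (0 : E d) hδ] with z hz
    have hz' : ‖z‖ / δ ≤ 1 := (div_le_one hδ).2 (mem_ball_zero_iff.1 hz).le
    rw [cutProfile, Real.smoothTransition.zero_of_nonpos (by linarith), mul_zero]
  · exact ((contDiffOn_cutProfile t δ).contDiffAt (isOpen_Iio.mem_nhds
      (mem_unitBall.1 hx))).comp x (contDiffAt_norm ℝ hx0)

/-- The point is that $C$ does not depend on $\delta$: the cutoff has slope $O(1/\delta)$, but it
multiplies a profile that is $O(s)$, with $s\le 2\delta$. -/
lemma exists_bound_sub_cutProfile (t : ℝ) :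
    ∃ C : ℝ, 0 ≤ C ∧ ∀ δ : ℝ, 0 < δ → δ ≤ 1 / 4 → ∀ s : ℝ, 0 ≤ s → s < 1 →
      |funkProfile t s - cutProfile t δ s| ≤ C ∧
      |deriv (fun s => funkProfile t s - cutProfile t δ s) s| ≤ C ∧
      (2 * δ < s → funkProfile t s - cutProfile t δ s = 0 ∧
        deriv (fun s => funkProfile t s - cutProfile t δ s) s = 0) := by
  have hsub : Icc (0 : ℝ) (1 / 2) ⊆ Iio 1 := fun s hs => hs.2.trans_lt (by norm_num)
  obtain ⟨A, hA⟩ := (isCompact_Icc (a := (0 : ℝ)) (b := 1 / 2)).exists_bound_of_continuousOn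
    (f := fun s : ℝ => (1 - s) ^ (-(1 / t))) (ContinuousOn.rpow_const (by fun_prop)
      fun s hs => .inl (sub_pos.2 (hsub hs)).ne')
  obtain ⟨C₁, hC₁⟩ := (isCompact_Icc (a := (0 : ℝ)) (b := 1 / 2)).exists_bound_of_continuousOn
    (((contDiffOn_funkProfile t).continuousOn_deriv_of_isOpen isOpen_Iio (by simp)).mono hsub)
  obtain ⟨C₂, hC₂⟩ := (isCompact_Icc (a := (-1 : ℝ)) (b := 1)).exists_bound_of_continuousOn
    ((Real.smoothTransition.contDiff (n := 1)).continuous_deriv (by simp)).continuousOn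
  have hA0 : 0 ≤ A := (norm_nonneg _).trans (hA 0 (by norm_num))
  have hC₁0 : 0 ≤ C₁ := (norm_nonneg _).trans (hC₁ 0 (by norm_num))
  have hC₂0 : 0 ≤ C₂ := (norm_nonneg _).trans (hC₂ 0 (by norm_num))
  -- The term $2AC_2$ bounds $As\cdot C_2/\delta$ for $s\le 2\delta$; the condition $\delta\le 1/4$
  -- keeps $2\delta$ within $[0,1/2]$, where $A$ and $C_1$ are valid.
  refine ⟨A + C₁ + 2 * A * C₂, by positivity, fun δ hδ hδ' s h0 hs => ?_⟩
  have hzero : ∀ s, 2 * δ < s → funkProfile t s - cutProfile t δ s = 0 := fun s hs => by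
    have : 2 ≤ s / δ := by rw [le_div_iff₀ hδ]; exact hs.le
    rw [cutProfile, Real.smoothTransition.one_of_one_le (by linarith), mul_one, sub_self]
  have hzero' : 2 * δ < s → deriv (fun s => funkProfile t s - cutProfile t δ s) s = 0 := by
    intro hs
    have : (fun s => funkProfile t s - cutProfile t δ s) =ᶠ[𝓝 s] fun _ => 0 := by
      filter_upwards [isOpen_Ioi.mem_nhds hs] with z hz using hzero z hz
    rw [this.deriv_eq, deriv_const]
  have hC0 : 0 ≤ A + C₁ + 2 * A * C₂ := by positivity
  by_cases hs2 : 2 * δ < s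
  · rw [hzero s hs2, hzero' hs2, abs_zero]
    exact ⟨hC0, hC0, fun _ => ⟨rfl, rfl⟩⟩
  rw [not_lt] at hs2
  have hs' : s ∈ Icc (0 : ℝ) (1 / 2) := ⟨h0, by linarith⟩
  have hsd : s / δ ≤ 2 := by rw [div_le_iff₀ hδ]; exact hs2
  have hsd0 : 0 ≤ s / δ := by positivity
  set T := Real.smoothTransition (s / δ - 1) with hT
  have hT1 : |1 - T| ≤ 1 := by
    rw [abs_le]
    constructor <;> linarith [Real.smoothTransition.nonneg (s / δ - 1),
      Real.smoothTransition.le_one (s / δ - 1)]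
  have hf : |funkProfile t s| ≤ A * s := by
    rw [funkProfile, abs_mul, abs_of_nonneg h0, mul_comm]
    exact mul_le_mul_of_nonneg_right (hA s hs') h0
  have hder : HasDerivAt (fun s => funkProfile t s - cutProfile t δ s)
      (deriv (funkProfile t) s * (1 - T) -
        funkProfile t s * (deriv Real.smoothTransition (s / δ - 1) * (1 / δ))) s := by
    have h1 := ((hasDerivAt_funkProfile t hs).differentiableAt).hasDerivAt
    have h2 : HasDerivAt Real.smoothTransition (deriv Real.smoothTransition (s / δ - 1))
        (s / δ - 1) :=
      (((Real.smoothTransition.contDiff (n := 1)).differentiable (by simp)) _).hasDerivAt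
    have h3 := h2.comp s (((hasDerivAt_id s).div_const δ).sub_const 1)
    refine (h1.sub (h1.mul h3)).congr_deriv ?_
    simp only [Function.comp_apply, id]
    ring
  refine ⟨?_, ?_, fun h => absurd hs2 (not_le.2 h)⟩
  · have : funkProfile t s - cutProfile t δ s = funkProfile t s * (1 - T) := by
      rw [cutProfile]; ring
    rw [this, abs_mul]
    calc _ ≤ A * s * 1 := mul_le_mul hf hT1 (abs_nonneg _) (by positivity)
      _ ≤ A * 1 := by rw [mul_one]; exact mul_le_mul_of_nonneg_left hs.le hA0
      _ ≤ _ := by nlinarith [mul_nonneg hA0 hC₂0]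
  · rw [hder.deriv]
    refine (abs_sub _ _).trans ?_
    rw [abs_mul, abs_mul, abs_mul, abs_of_pos (one_div_pos.2 hδ)]
    have hD1 : |deriv (funkProfile t) s| * |1 - T| ≤ C₁ * 1 :=
      mul_le_mul (hC₁ s hs') hT1 (abs_nonneg _) hC₁0
    have hD2 : |deriv Real.smoothTransition (s / δ - 1)| ≤ C₂ :=
      hC₂ _ ⟨by linarith, by linarith⟩
    have hD3 : |funkProfile t s| * (|deriv Real.smoothTransition (s / δ - 1)| * (1 / δ)) ≤
        A * s * (C₂ * (1 / δ)) := by gcongr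
    have hD4 : A * s * (C₂ * (1 / δ)) = A * C₂ * (s / δ) := by ring
    have hD5 : A * C₂ * (s / δ) ≤ A * C₂ * 2 := by gcongr
    linarith

/-- Whatever the sign of $k'$, $|k'| - k's\le 2C$ for $0\le s<1$. The hypotheses are invariant under
$k\mapsto -k$, so one estimate serves both orders of the difference in the asymmetric norm. -/
lemma sobolevNorm_radial_le_of_support (hd : 2 ≤ d) {k : ℝ → ℝ} (hk : ContDiffOn ℝ ∞ k (Iio 1))
    {p : ℝ} (hp : 0 < p) {C r : ℝ} (hC : 0 ≤ C) (h : ∀ s, 0 ≤ s → s < 1 → |k s| ≤ C ∧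
      |deriv k s| ≤ C ∧ (r < s → k s = 0 ∧ deriv k s = 0)) :
    sobolevNorm (unitBall d) kleinMetric funkForm p (fun x : E d => k ‖x‖) ≤
      (2 * ENNReal.ofReal (2 * C) ^ p * volume (Metric.closedBall (0 : E d) r)) ^ (1 / p) := by
  have hb : ∀ x ∈ unitBall d, ∀ z : ℝ, z ≤ 2 * C → (r < ‖x‖ → z = 0) → ENNReal.ofReal z ^ p ≤
      (Metric.closedBall (0 : E d) r).indicator (fun _ => ENNReal.ofReal (2 * C) ^ p) x := by
    intro x hx z hz hz0
    by_cases hxr : x ∈ Metric.closedBall (0 : E d) r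
    · rw [indicator_of_mem hxr]
      exact ENNReal.rpow_le_rpow (ENNReal.ofReal_le_ofReal hz) hp.le
    · rw [hz0 (by simpa using hxr)]
      simp [hp]
  refine (sobolevNorm_radial_le hd hk hp
    (A := (Metric.closedBall (0 : E d) r).indicator fun _ => ENNReal.ofReal (2 * C) ^ p)
    (B := (Metric.closedBall (0 : E d) r).indicator fun _ => ENNReal.ofReal (2 * C) ^ p)
    (fun x hx => ?_) (fun x hx => ?_)).trans ?_
  · obtain ⟨-, h2, h3⟩ := h _ (norm_nonneg x) (mem_unitBall.1 hx)
    refine hb x hx _ ?_ fun hr => by rw [(h3 hr).2]; simp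
    have h4 : -(deriv k ‖x‖ * ‖x‖) ≤ |deriv k ‖x‖| := by
      refine (neg_le_abs _).trans ?_
      rw [abs_mul, abs_norm]
      exact mul_le_of_le_one_right (abs_nonneg _) (mem_unitBall.1 hx).le
    linarith
  · obtain ⟨h1, -, h3⟩ := h _ (norm_nonneg x) (mem_unitBall.1 hx)
    rw [Real.enorm_eq_ofReal_abs]
    refine hb x hx _ (by linarith) fun hr => by rw [(h3 hr).1, abs_zero]
  · refine ENNReal.rpow_le_rpow ?_ (by positivity)
    have : ∫⁻ x in unitBall d, (Metric.closedBall (0 : E d) r).indicator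
        (fun _ => ENNReal.ofReal (2 * C) ^ p) x ≤
        ENNReal.ofReal (2 * C) ^ p * volume (Metric.closedBall (0 : E d) r) := by
      rw [← lintegral_indicator_const Metric.isClosed_closedBall.measurableSet]
      exact setLIntegral_le_lintegral _ _
    refine (add_le_add this this).trans_eq ?_
    ring

lemma tendsto_volume_closedBall (hd : 2 ≤ d) {p : ℝ} (hp : 0 < p) {c : ℝ≥0∞} (hc : c ≠ ⊤) :
    Tendsto (fun δ : ℝ => (c * volume (Metric.closedBall (0 : E d) (2 * δ))) ^ (1 / p))
      (𝓝[>] 0) (𝓝 0) := by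
  have hV : Tendsto (fun δ : ℝ => volume (Metric.closedBall (0 : E d) (2 * δ))) (𝓝[>] 0) (𝓝 0) := by
    have h1 : Tendsto (fun δ : ℝ => ENNReal.ofReal ((2 * δ) ^ Module.finrank ℝ (E d)) *
        volume (Metric.ball (0 : E d) 1)) (𝓝[>] 0) (𝓝 0) := by
      have h2 : Tendsto (fun δ : ℝ => (2 * δ) ^ Module.finrank ℝ (E d)) (𝓝[>] 0) (𝓝 0) := by
        have : Continuous (fun δ : ℝ => (2 * δ) ^ Module.finrank ℝ (E d)) := by fun_prop
        refine (this.tendsto' 0 0 ?_).mono_left nhdsWithin_le_nhds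
        rw [mul_zero, finrank_euclideanSpace_fin, zero_pow (by omega)]
      have h3 := ENNReal.Tendsto.mul_const (b := volume (Metric.ball (0 : E d) 1))
        (ENNReal.tendsto_ofReal h2) (.inr measure_ball_lt_top.ne)
      simpa using h3
    refine h1.congr' ?_
    filter_upwards [self_mem_nhdsWithin] with δ hδ
    rw [Measure.addHaar_closedBall _ _ (by linarith [show (0 : ℝ) < δ from hδ])]
  have h := ((ENNReal.continuous_rpow_const (y := 1 / p)).tendsto _).comp
    (ENNReal.Tendsto.const_mul hV (.inr hc))
  have hp' : 0 < 1 / p := by positivity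
  rwa [mul_zero, ENNReal.zero_rpow_of_pos hp'] at h

lemma memSobolev_funkFunction (hd : 2 ≤ d) {p t : ℝ} (hp : 0 < p) (hpt : p < t) :
    MemSobolev (unitBall d) kleinMetric funkForm p (funkFunction t) where
  memLoc := memSobolevLoc_of_lipschitz (lipschitzOnWith_radial (contDiffOn_funkProfile t)) p
  norm_lt_top := sobolevNorm_funkFunction_lt_top hd hp hpt
  mem_closure ε hε := by
    obtain ⟨C, hC, hb⟩ := exists_bound_sub_cutProfile t
    have hlim := tendsto_volume_closedBall hd hp (c := 2 * ENNReal.ofReal (2 * C) ^ p)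
      (ENNReal.mul_ne_top (by simp) (ENNReal.rpow_ne_top_of_nonneg hp.le ENNReal.ofReal_ne_top))
    obtain ⟨δ, hδε, hδ0, hδ1⟩ := ((hlim.eventually_lt_const hε).and
      (Ioc_mem_nhdsGT (show (0 : ℝ) < 1 / 4 by norm_num))).exists
    have hk := (contDiffOn_funkProfile t).sub (contDiffOn_cutProfile t δ)
    refine ⟨fun x => cutProfile t δ ‖x‖, contDiffOn_cutProfile_norm t hδ0, ?_, ?_⟩
    · exact (sobolevNorm_radial_le_of_support hd hk hp hC (hb δ hδ0 hδ1)).trans_lt hδε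
    · refine lt_of_le_of_lt ?_ hδε
      have e : (fun x : E d => cutProfile t δ ‖x‖ - funkFunction t x) =
          fun x => (fun s => -(funkProfile t s - cutProfile t δ s)) ‖x‖ := by
        funext x
        rw [funkFunction_eq]
        ring
      rw [e]
      refine sobolevNorm_radial_le_of_support hd hk.neg hp hC fun s h0 hs => ?_
      obtain ⟨h1, h2, h3⟩ := hb δ hδ0 hδ1 s h0 hs
      rw [deriv.fun_neg, abs_neg, abs_neg]
      exact ⟨h1, h2, fun h => ⟨by rw [(h3 h).1, neg_zero], by rw [(h3 h).2, neg_zero]⟩⟩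

/-! ### The exponent of an admissible pair -/

lemma IsAdmissible.exists_exponent (hd : 2 ≤ d) {p : ℝ} {q : ℝ≥0∞} (h : IsAdmissible d p q) :
    ∃ t : ℝ, p < t ∧ ENNReal.ofReal t ≤ q ∧ (q ≠ ⊤ → t = (p + q.toReal) / 2) ∧
      (q = ⊤ → t = p ^ 2 / d) := by
  obtain ⟨hp1, h⟩ := h
  have hp : 0 < p := one_pos.trans hp1
  by_cases hq : q = ⊤
  · subst hq
    have hdp : (d : ℝ) < p := by
      rcases h with ⟨-, -, h⟩ | ⟨-, -, h⟩ | ⟨h, -⟩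
      · exact absurd h (by simp)
      · exact absurd h (by simp)
      · exact h
    have hd0 : (0 : ℝ) < d := by exact_mod_cast (by omega : 0 < d)
    refine ⟨p ^ 2 / d, ?_, le_top, fun h => absurd rfl h, fun _ => rfl⟩
    rw [lt_div_iff₀ hd0]
    -- For $q=\infty$, $p<p^2/d$ is the condition $d<p$.
    nlinarith
  · have hpq : ENNReal.ofReal p < q := by
      rcases h with ⟨-, h, -⟩ | ⟨-, h, -⟩ | ⟨-, h⟩
      · exact h
      · exact h
      · exact absurd h hq
    have hpq' : p < q.toReal := (ENNReal.ofReal_lt_iff_lt_toReal hp.le hq).1 hpq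
    refine ⟨(p + q.toReal) / 2, by linarith, ?_, fun _ => rfl, fun h => absurd h hq⟩
    rw [ENNReal.ofReal_le_iff_le_toReal hq]
    linarith

end FunkModel

theorem mainTheorem6 (d : ℕ) (hd : 2 ≤ d) :
    FunkModel.IsRandersSpace (FunkModel.unitBall d) FunkModel.kleinMetric FunkModel.funkForm ∧
    (∀ x ∈ FunkModel.unitBall d, ∀ y : FunkModel.E d,
      FunkModel.funkMetric x y =
        FunkModel.randersMetric FunkModel.kleinMetric FunkModel.funkForm x y) ∧
    FunkModel.IsHadamard (FunkModel.unitBall d) FunkModel.kleinMetric ∧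
    IsLUB (FunkModel.formNorm FunkModel.kleinMetric FunkModel.funkForm '' FunkModel.unitBall d) 1 ∧
    FunkModel.reversibility (FunkModel.unitBall d) FunkModel.funkMetric = ⊤ ∧
    ∀ (p : ℝ) (q : ℝ≥0∞), FunkModel.IsAdmissible d p q →
      (∃ t : ℝ, 0 < t ∧ (q ≠ ⊤ → t = (p + q.toReal) / 2) ∧ (q = ⊤ → t = p ^ 2 / d) ∧
        FunkModel.MemSobolev (FunkModel.unitBall d) FunkModel.kleinMetric FunkModel.funkForm p
          (FunkModel.funkFunction t) ∧
        eLpNorm (FunkModel.funkFunction t) q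
          (FunkModel.randersVolume (FunkModel.unitBall d) FunkModel.kleinMetric
            FunkModel.funkForm) = ⊤) ∧
      ¬ FunkModel.ContinuouslyEmbeds (FunkModel.unitBall d) FunkModel.kleinMetric
          FunkModel.funkForm p q := by
  refine ⟨FunkModel.isRandersSpace_funk,
    fun x hx y => FunkModel.randersMetric_eq_funkMetric hx y, FunkModel.isHadamard_kleinMetric,
    FunkModel.isLUB_formNorm hd, FunkModel.reversibility_funk hd, fun p q hpq => ?_⟩
  obtain ⟨t, hpt, htq, h1, h2⟩ := hpq.exists_exponent hd
  have hp : 0 < p := one_pos.trans hpq.1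
  have hmem := FunkModel.memSobolev_funkFunction hd hp hpt
  have htop := FunkModel.eLpNorm_funkFunction_eq_top hd (hp.trans hpt) htq
  refine ⟨⟨t, hp.trans hpt, h1, h2, hmem, htop⟩, fun ⟨C, hC⟩ => ?_⟩
  have := hC _ hmem
  rw [htop, top_le_iff] at this
  exact (ENNReal.mul_lt_top ENNReal.coe_lt_top hmem.norm_lt_top).ne this
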